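/- **Setting.** Let $M\ge 2$ be the number of secondary users, one of which, $v$, is scheduled to transmit; the other $M-1$ are relays. All channel coefficients $h_{\ell_1,\ell_2}$ (from the primary source $\mathrm p$ and the secondary users to the primary destination $\mathrm{pd}$, the secondary destination $\mathrm{sd}$ and the secondary users other than $v$, with $\ell_1\neq\ell_2$) are i.i.d. $\mathcal{CN}(0,1)$. The noise variance is $N_0>0$; the primary source, and the relays jointly, transmit the primary packet with power $P$; user $v$ transmits its own packet with fixed power $P_s>0$. Put $\gamma=P/N_0$ and $\gamma_s=P_s/N_0$; "high SNR" means $\gamma\to\infty$ with $\gamma_s$ fixed. In the first half of the slot the primary source broadcasts at rate $2R$ bits/s/Hz, and a relay $k\ne v$ belongs to the decoding set $\Lambda$ iff $\log_2(1+\gamma|h_{\mathrm p,k}|^2)\ge 2R$. In the second half $v$ transmits its own packet and, if $|\Lambda|\ge 2$, the relays in $\Lambda$ forward the primary packet with a weight vector $g$ that maximizes $|g^\dagger h^{(\Lambda)}_{\mathrm{pd}}|^2$ subject to $\|g\|=1$ and $g^\dagger h^{(\Lambda)}_{\mathrm{sd}}=0$, where $h^{(\Lambda)}_{u}=(h_{k,u})_{k\in\Lambda}$.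 Let $\alpha_\Lambda$ be this maximum. The primary link is in outage iff either - $|\Lambda|\ge2$ and $\log_2\!\Big(1+\dfrac{\alpha_\Lambda P}{N_0+P_s|h_{v,\mathrm{pd}}|^2}+\gamma|h_{\mathrm p,\mathrm{pd}}|^2\Big)<2R$, or - $|\Lambda|<2$ and $\log_2\!\big(1+\gamma|h_{\mathrm p,\mathrm{pd}}|^2\big)<2R$. Let $\nu(\gamma,R)$ be the probability of outage and $Q=(2^{2R}-1)/\gamma$. A rate family is a function $R(\gamma)$ that is bounded below by a positive constant for all large $\gamma$. It has multiplexing gain $r$ if $R(\gamma)/\log_2\gamma\to r$, and the protocol has diversity $d$ with it if $\log\nu(\gamma,R(\gamma))/\log\gamma\to-d$, both as $\gamma\to\infty$. The protocol *achieves* $(r,d)$ if some rate family has multiplexing gain $r$ and diversity $d$. **Statement.** 1. (Scaling.) Let $$C=\sum_{K=2}^{M-1}\binom{M-1}{K}\frac1{K!}\int_0^\infty(1+\gamma_s a)^{K-1}e^{-a}\,da+(M-1).$$ Then $C>0$, and for every $R(\gamma)$ that is positive for all large $\gamma$ and satisfies $Q(\gamma)=(2^{2R(\gamma)}-1)/\gamma\to0$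 as $\gamma\to\infty$ (for example every constant rate), $$\lim_{\gamma\to\infty}\frac{\nu(\gamma,R(\gamma))}{Q(\gamma)^{M-1}}=C .$$ 2. (Diversity-multiplexing tradeoff.) For every $0\le r\le\frac12$, every rate family of multiplexing gain $r$ has diversity $$d(r)=(1-2r)(M-1).$$ 3. (Maximum diversity.) The largest $d$ such that $(r,d)$ is achieved for some $r$ is $M-1$. 4. (Maximum multiplexing gain.) The supremum of the $r$ such that $(r,d)$ is achieved for some $d>0$ is $\frac12$. -/

import Mathlib

open MeasureTheory ProbabilityTheory Filter Topology
open scoped NNReal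

noncomputable section

namespace CognitiveRelay

/-- The law `CN(0,1)` on `ℂ`: circularly symmetric complex Gaussian with zero mean and unit
variance, that is, independent real and imaginary parts, each `N(0, 1/2)`. -/
def complexGaussian : Measure ℂ :=
  Measure.map (fun p : ℝ × ℝ => (⟨p.1, p.2⟩ : ℂ))
    ((gaussianReal 0 (1 / 2 : ℝ≥0)).prod (gaussianReal 0 (1 / 2 : ℝ≥0)))

/-- Transmitting nodes: the primary source and the `M` secondary users. -/
inductive Tx (M : ℕ) : Type
  | primary : Tx M
  | secondary (i : Fin M) : Tx M

/-- Receiving nodes: the primary destination, the secondary destination and the `M` secondary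
users. -/
inductive Rx (M : ℕ) : Type
  | primaryDest : Rx M
  | secondaryDest : Rx M
  | secondary (i : Fin M) : Rx M

/-- The pairs (transmitter, receiver) that are links of the network when user `v` is scheduled:
no node is linked to itself, and the transmitting user `v` does not receive. -/
def IsLink {M : ℕ} (v : Fin M) : Tx M → Rx M → Prop
  | .primary, .secondary j => j ≠ v
  | .secondary i, .secondary j => i ≠ j ∧ j ≠ v
  | _, _ => True

/-- Rayleigh fading: the channel coefficients of the links are i.i.d. `CN(0,1)` random variables. -/
structure IsRayleighFading {Ω : Type*} [MeasurableSpace Ω] (μ : Measure Ω) {M : ℕ} (v : Fin M)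
    (h : Tx M → Rx M → Ω → ℂ) : Prop where
  hasLaw : ∀ (t : Tx M) (u : Rx M), IsLink v t u → HasLaw (h t u) complexGaussian μ
  indep : iIndepFun (fun l : {l : Tx M × Rx M // IsLink v l.1 l.2} => h l.1.1 l.1.2) μ

/-- The value of the zero-forcing beamforming problem: the maximum of `|g† hpd|²` over the
weight vectors `g` with `‖g‖ = 1` and `g† hsd = 0`. -/
def zfGain {ι : Type*} [Fintype ι] (hpd hsd : EuclideanSpace ℂ ι) : ℝ :=
  sSup {a : ℝ | ∃ g : EuclideanSpace ℂ ι,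
    ‖g‖ = 1 ∧ inner ℂ g hsd = 0 ∧ a = ‖inner ℂ g hpd‖ ^ 2}

/-- With at least two relays the supremum in `zfGain` is attained by some weight vector. -/
theorem isGreatest_zfGain {ι : Type*} [Fintype ι] (hι : 2 ≤ Fintype.card ι)
    (hpd hsd : EuclideanSpace ℂ ι) :
    IsGreatest {a : ℝ | ∃ g : EuclideanSpace ℂ ι,
      ‖g‖ = 1 ∧ inner ℂ g hsd = 0 ∧ a = ‖inner ℂ g hpd‖ ^ 2} (zfGain hpd hsd) := by
  have hS : {a : ℝ | ∃ g : EuclideanSpace ℂ ι,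
      ‖g‖ = 1 ∧ inner ℂ g hsd = 0 ∧ a = ‖inner ℂ g hpd‖ ^ 2} =
      (fun g : EuclideanSpace ℂ ι => ‖inner ℂ g hpd‖ ^ 2) ''
        (Metric.sphere 0 1 ∩ {g | inner ℂ g hsd = 0}) := by
    ext a
    simp only [Set.mem_ofPred_eq, Set.mem_image, Set.mem_inter_iff, mem_sphere_zero_iff_norm]
    exact ⟨fun ⟨g, h1, h2, h3⟩ => ⟨g, ⟨h1, h2⟩, h3.symm⟩,
      fun ⟨g, ⟨h1, h2⟩, h3⟩ => ⟨g, h1, h2, h3.symm⟩⟩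
  have hc : IsCompact (Metric.sphere (0 : EuclideanSpace ℂ ι) 1 ∩ {g | inner ℂ g hsd = 0}) :=
    (isCompact_sphere _ _).inter_right (isClosed_eq (by fun_prop) continuous_const)
  have hne : (Metric.sphere (0 : EuclideanSpace ℂ ι) 1 ∩ {g | inner ℂ g hsd = 0}).Nonempty := by
    have hpos : 0 < Module.finrank ℂ (Submodule.span ℂ {hsd})ᗮ := by
      have h1 := Submodule.finrank_add_finrank_orthogonal (Submodule.span ℂ {hsd})
      have h2 : Module.finrank ℂ (Submodule.span ℂ {hsd}) ≤ 1 := by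
        simpa using finrank_span_le_card (R := ℂ) ({hsd} : Set (EuclideanSpace ℂ ι))
      have h3 : Module.finrank ℂ (EuclideanSpace ℂ ι) = Fintype.card ι := finrank_euclideanSpace
      omega
    obtain ⟨⟨x, hx⟩, hx0⟩ := Module.finrank_pos_iff_exists_ne_zero.mp hpos
    have hx0' : x ≠ 0 := fun h => hx0 (Subtype.ext h)
    have hxs : inner ℂ x hsd = 0 :=
      (Submodule.mem_orthogonal' _ _).mp hx hsd (Submodule.mem_span_singleton_self hsd)
    refine ⟨((‖x‖⁻¹ : ℝ) : ℂ) • x, ?_, ?_⟩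
    · simp [norm_smul, hx0']
    · simp [hxs]
  have hcont : Continuous (fun g : EuclideanSpace ℂ ι => ‖inner ℂ g hpd‖ ^ 2) := by fun_prop
  have hc' := hc.image hcont
  unfold zfGain
  rw [hS]
  exact ⟨hc'.sSup_mem (hne.image _), fun a ha => le_csSup hc'.bddAbove ha⟩

open Classical in
/-- The decoding set `Λ`: the secondary users `k ≠ v` whose channel from the primary source has
capacity at least the primary rate `2R` (the packet is sent in half of the slot). Here `γ` is the
signal-to-noise ratio and `x` the realization. -/
def decodingSet {Ω : Type*} {M : ℕ} (v : Fin M) (h : Tx M → Rx M → Ω → ℂ) (γ R : ℝ) (x : Ω) :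
    Finset (Fin M) :=
  Finset.univ.filter fun k =>
    k ≠ v ∧ 2 * R ≤ Real.logb 2 (1 + γ * ‖h .primary (.secondary k) x‖ ^ 2)

/-- The vector of channel coefficients from the relays in `S` to the receiver `u`. -/
def relayVector {Ω : Type*} {M : ℕ} (h : Tx M → Rx M → Ω → ℂ) (S : Finset (Fin M)) (u : Rx M)
    (x : Ω) : EuclideanSpace ℂ S :=
  WithLp.toLp 2 fun k => h (.secondary k) u x

/-- SNR of the primary direct link. -/
def directSNR {Ω : Type*} {M : ℕ} (h : Tx M → Rx M → Ω → ℂ) (N₀ P : ℝ) (x : Ω) : ℝ :=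
  P / N₀ * ‖h .primary .primaryDest x‖ ^ 2

/-- SINR at the primary destination of the signal beamformed by the relays in `S`, with the
optimal zero-forcing weights, while user `v` transmits with power `Ps`. -/
def relaySINR {Ω : Type*} {M : ℕ} (v : Fin M) (h : Tx M → Rx M → Ω → ℂ) (N₀ P Ps : ℝ)
    (S : Finset (Fin M)) (x : Ω) : ℝ :=
  zfGain (relayVector h S .primaryDest x) (relayVector h S .secondaryDest x) * P /
    (N₀ + Ps * ‖h (.secondary v) .primaryDest x‖ ^ 2)

/-- Primary outage event. Either at least two relays decode and the maximal ratio combination of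
the direct and relayed signals is undecodable at rate `2R`, or fewer than two relays decode (so
that none forwards) and the direct link is in outage at rate `2R`. -/
def outageEvent {Ω : Type*} {M : ℕ} (v : Fin M) (h : Tx M → Rx M → Ω → ℂ) (N₀ P Ps R : ℝ) :
    Set Ω :=
  {x | 2 ≤ (decodingSet v h (P / N₀) R x).card ∧
      Real.logb 2 (1 + (relaySINR v h N₀ P Ps (decodingSet v h (P / N₀) R x) x
        + directSNR h N₀ P x)) < 2 * R} ∪
  {x | (decodingSet v h (P / N₀) R x).card < 2 ∧
      Real.logb 2 (1 + directSNR h N₀ P x) < 2 * R}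

/-- Primary outage probability at signal-to-noise ratio `γ = P / N₀`, with `N₀` and `Ps` fixed. -/
def outageProb {Ω : Type*} [MeasurableSpace Ω] (μ : Measure Ω) {M : ℕ} (v : Fin M)
    (h : Tx M → Rx M → Ω → ℂ) (N₀ Ps γ R : ℝ) : ℝ :=
  μ.real (outageEvent v h N₀ (γ * N₀) Ps R)

/-- `Q = (2^{2R} - 1) / γ`. -/
def outageScale (γ R : ℝ) : ℝ := ((2 : ℝ) ^ (2 * R) - 1) / γ

/-- A rate family `R(γ)` that is bounded away from `0` at high SNR. -/
def IsRateFamily (R : ℝ → ℝ) : Prop := ∃ R₀ : ℝ, 0 < R₀ ∧ ∀ᶠ γ in atTop, R₀ ≤ R γ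

/-- Multiplexing gain `r` (rates are in bits, hence the logarithm to base `2`). -/
def HasMultiplexingGain (R : ℝ → ℝ) (r : ℝ) : Prop :=
  Tendsto (fun γ : ℝ => R γ / Real.logb 2 γ) atTop (𝓝 r)

/-- Diversity `d` of an outage probability `ν(γ)`. -/
def HasDiversity (ν : ℝ → ℝ) (d : ℝ) : Prop :=
  Tendsto (fun γ : ℝ => Real.log (ν γ) / Real.log γ) atTop (𝓝 (-d))

/-- The protocol achieves diversity `d` at multiplexing gain `r`. -/
def Achieves {Ω : Type*} [MeasurableSpace Ω] (μ : Measure Ω) {M : ℕ} (v : Fin M)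
    (h : Tx M → Rx M → Ω → ℂ) (N₀ Ps r d : ℝ) : Prop :=
  ∃ R : ℝ → ℝ, IsRateFamily R ∧ HasMultiplexingGain R r ∧
    HasDiversity (fun γ => outageProb μ v h N₀ Ps γ (R γ)) d

/-- The coefficient of `Q^{M-1}` in the high-SNR expansion of the outage probability, where
`γs` is the secondary signal-to-noise ratio. The integral is the mean of `(1 + γs |h|²)^{K-1}` for
`h` of law `CN(0,1)`. -/
def outageCoeff (M : ℕ) (γs : ℝ) : ℝ :=
  ∑ K ∈ Finset.Icc 2 (M - 1), ((M - 1).choose K : ℝ) * (1 / (K.factorial : ℝ)) *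
      (∫ a in Set.Ioi (0 : ℝ), (1 + γs * a) ^ (K - 1) * Real.exp (-a)) + ((M : ℝ) - 1)

end CognitiveRelay

end

/-! All outage conditions are thresholds at the single level `Q = outageScale γ R`, so the outage
probability is a function of `Q` alone (`outageProb_eq_sum`, `outageFun`). Split it over the
decoding set `S`, with `K` elements. Squared channel moduli are unit exponentials, with distribution
function `F(Q) ~ Q`, so the decoding set is `S` with probability `(1 - F)^K F^(M-1-K)`.

Given `S` with `K ≥ 2`, the zero-forcing gain is the squared norm of the component of the relay
vector orthogonal to the secondary one (`zfGain_eq`). By unitary invariance of the Gaussian law it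
is distributed as a sum of `K - 1` unit exponentials. With interference `a` and `c = 1 + γs a`,
outage means that this sum divided by `c`, plus the direct exponential, is below `Q`. This has
probability at most `c^(K-1) Q^K / K!` and at least `e^(-cQ)` times that. Averaging over the
exponential variable `a`, by dominated convergence, gives the factor of `Q^K`. Together with
`F^(M-1-K)` every such `S` contributes at order `Q^(M-1)`. For `K = 1` only the direct link remains,
and each of the `M - 1` singletons contributes `Q^(M-1)`; for `K = 0` the contribution has order
`Q^M` and disappears in the limit. This is the scaling law.

For the tradeoff, multiplexing gain `r` gives `log Q / log γ → 2r - 1`. If `r < 1/2` then `Q → 0`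
and the scaling law yields the diversity. If `r ≥ 1/2` then `Q` need not vanish; the bound `ν ≥ F^M`
and `ν ≤ 1` force diversity `0`. The extremal claims follow by uniqueness of limits. -/

noncomputable section

namespace CognitiveRelay

open scoped ENNReal

/-! ### The complex Gaussian law: squared modulus and characteristic function -/

/-- The exponential law with unit mean. -/
def expLaw : Measure ℝ :=
  (volume.restrict (Set.Ioi 0)).withDensity fun x => ENNReal.ofReal (Real.exp (-x))

theorem lintegral_expLaw (g : ℝ → ℝ≥0∞) (hg : Measurable g) :
    ∫⁻ x, g x ∂expLaw = ∫⁻ x in Set.Ioi 0, ENNReal.ofReal (Real.exp (-x)) * g x := by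
  rw [expLaw, lintegral_withDensity_eq_lintegral_mul _ (by fun_prop) hg]
  rfl

theorem measurable_complex_mk : Measurable (fun p : ℝ × ℝ => (⟨p.1, p.2⟩ : ℂ)) :=
  Complex.measurableEquivRealProd.symm.measurable

instance : IsProbabilityMeasure complexGaussian :=
  Measure.isProbabilityMeasure_map measurable_complex_mk.aemeasurable

theorem gaussianPDF_mul_gaussianPDF (x y : ℝ) :
    gaussianPDF 0 (1 / 2) x * gaussianPDF 0 (1 / 2) y =
      ENNReal.ofReal (Real.pi⁻¹ * Real.exp (-(x ^ 2 + y ^ 2))) := by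
  rw [gaussianPDF, gaussianPDF, ← ENNReal.ofReal_mul (gaussianPDFReal_nonneg _ _ _)]
  congr 1
  simp only [gaussianPDFReal]
  have h : Real.sqrt (2 * Real.pi * ((1 / 2 : ℝ≥0) : ℝ)) *
      Real.sqrt (2 * Real.pi * ((1 / 2 : ℝ≥0) : ℝ)) = Real.pi := by
    rw [Real.mul_self_sqrt (by positivity)]
    push_cast
    ring
  rw [mul_mul_mul_comm, ← mul_inv, h, ← Real.exp_add]
  congr 2
  push_cast
  ring

theorem lintegral_two_mul_exp_sq (g : ℝ → ℝ≥0∞) :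
    ∫⁻ r in Set.Ioi (0 : ℝ), ENNReal.ofReal (2 * r) *
      (ENNReal.ofReal (Real.exp (-r ^ 2)) * g (r ^ 2)) =
    ∫⁻ x in Set.Ioi (0 : ℝ), ENNReal.ofReal (Real.exp (-x)) * g x := by
  have hmono : MonotoneOn (fun r : ℝ => r ^ 2) (Set.Ioi 0) := fun a ha b hb hab =>
    pow_le_pow_left₀ (le_of_lt ha) hab 2
  have him : (fun r : ℝ => r ^ 2) '' Set.Ioi 0 = Set.Ioi 0 := by
    ext x
    constructor
    · rintro ⟨r, hr, rfl⟩
      exact pow_pos (Set.mem_Ioi.1 hr) 2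
    · intro hx
      exact ⟨Real.sqrt x, Real.sqrt_pos.2 hx, Real.sq_sqrt (le_of_lt hx)⟩
  have := lintegral_image_eq_lintegral_deriv_mul_of_monotoneOn (s := Set.Ioi (0 : ℝ))
    (f := fun r => r ^ 2) (f' := fun r => 2 * r) measurableSet_Ioi
    (fun x _ => by simpa using (hasDerivAt_pow 2 x).hasDerivWithinAt) hmono
    (fun x => ENNReal.ofReal (Real.exp (-x)) * g x)
  rw [him] at this
  exact this.symm

/-- Polar coordinates: the joint density `π⁻¹ exp(-r²)` has no angular dependence, so the angle
contributes `2π`. The remaining radial weight `2r exp(-r²)` becomes `exp(-x)` under `x = r²`. -/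
theorem lintegral_complexGaussian_normSq (g : ℝ → ℝ≥0∞) (hg : Measurable g) :
    ∫⁻ z, g (‖z‖ ^ 2) ∂complexGaussian = ∫⁻ x, g x ∂expLaw := by
  have hpdf : Measurable (gaussianPDF 0 (1 / 2)) := measurable_gaussianPDF _ _
  have h1 : Measurable (fun p : ℝ × ℝ => g (‖(⟨p.1, p.2⟩ : ℂ)‖ ^ 2)) :=
    Measurable.comp (g := fun z : ℂ => g (‖z‖ ^ 2)) (by fun_prop) measurable_complex_mk
  rw [complexGaussian, lintegral_map (by fun_prop) measurable_complex_mk,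
    gaussianReal_of_var_ne_zero _ (by norm_num), prod_withDensity hpdf hpdf,
    lintegral_withDensity_eq_lintegral_mul _ (by fun_prop) h1,
    lintegral_expLaw g hg, ← lintegral_two_mul_exp_sq, ← Measure.volume_eq_prod,
    ← lintegral_comp_polarCoord_symm, polarCoord_target, Measure.volume_eq_prod,
    ← Measure.prod_restrict, lintegral_prod]
  · refine setLIntegral_congr_fun measurableSet_Ioi fun r hr => ?_
    have hr' : (0 : ℝ) < r := hr
    have key : ∀ θ : ℝ, ENNReal.ofReal r •
        (((fun z : ℝ × ℝ => gaussianPDF 0 (1 / 2) z.1 * gaussianPDF 0 (1 / 2) z.2) *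
          fun p : ℝ × ℝ => g (‖(⟨p.1, p.2⟩ : ℂ)‖ ^ 2)) (polarCoord.symm (r, θ))) =
        ENNReal.ofReal (r * Real.pi⁻¹) * (ENNReal.ofReal (Real.exp (-r ^ 2)) * g (r ^ 2)) := by
      intro θ
      have h1 : (r * Real.cos θ) ^ 2 + (r * Real.sin θ) ^ 2 = r ^ 2 := by
        rw [mul_pow, mul_pow, ← mul_add, Real.cos_sq_add_sin_sq, mul_one]
      have h2 : ‖(⟨r * Real.cos θ, r * Real.sin θ⟩ : ℂ)‖ ^ 2 = r ^ 2 := by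
        rw [← Complex.normSq_eq_norm_sq, Complex.normSq_mk, ← h1]
        ring
      simp only [polarCoord_symm_apply, Pi.mul_apply, smul_eq_mul]
      rw [gaussianPDF_mul_gaussianPDF, h1, h2, ENNReal.ofReal_mul (by positivity),
        ENNReal.ofReal_mul (by positivity)]
      ring
    simp only [key]
    rw [lintegral_const, Measure.restrict_apply MeasurableSet.univ, Set.univ_inter,
      Real.volume_Ioo, mul_right_comm, ← ENNReal.ofReal_mul (by positivity)]
    congr 2
    field_simp
    ring
  · refine Measurable.aemeasurable ?_
    have h2 : Measurable (fun p : ℝ × ℝ => polarCoord.symm p) :=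
      continuous_polarCoord_symm.measurable
    have h3 : Measurable (fun z : ℝ × ℝ => gaussianPDF 0 (1 / 2) z.1 * gaussianPDF 0 (1 / 2) z.2) := by
      fun_prop
    exact (by fun_prop : Measurable (fun p : ℝ × ℝ => ENNReal.ofReal p.1)).smul
      ((h3.mul h1).comp h2)

theorem map_normSq_complexGaussian :
    Measure.map (fun z : ℂ => ‖z‖ ^ 2) complexGaussian = expLaw := by
  refine Measure.ext_of_lintegral _ fun g hg => ?_
  rw [lintegral_map hg (by fun_prop), lintegral_complexGaussian_normSq g hg]

instance : IsProbabilityMeasure expLaw := by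
  rw [← map_normSq_complexGaussian]
  exact Measure.isProbabilityMeasure_map (by fun_prop)

/-- Dependence on `‖t‖` alone is what later gives unitary invariance of Gaussian vectors. -/
theorem charFun_complexGaussian (t : ℂ) :
    charFun complexGaussian t = Complex.exp (-(‖t‖ ^ 2 / 4 : ℝ)) := by
  have hsplit : ∀ p : ℝ × ℝ, Complex.exp ((inner ℝ (⟨p.1, p.2⟩ : ℂ) t : ℝ) * Complex.I) =
      Complex.exp (t.re * p.1 * Complex.I) * Complex.exp (t.im * p.2 * Complex.I) := by
    intro p
    rw [← Complex.exp_add, Complex.inner]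
    congr 1
    simp
    ring
  have hm : Continuous fun z : ℂ => Complex.exp ((inner ℝ z t : ℝ) * Complex.I) := by fun_prop
  rw [charFun_apply, complexGaussian, integral_map measurable_complex_mk.aemeasurable
    hm.aestronglyMeasurable]
  simp_rw [hsplit]
  rw [integral_prod_mul (fun x : ℝ => Complex.exp (t.re * x * Complex.I))
    (fun x : ℝ => Complex.exp (t.im * x * Complex.I)), ← charFun_apply_real, ← charFun_apply_real,
    charFun_gaussianReal, charFun_gaussianReal, ← Complex.exp_add, ← Complex.normSq_eq_norm_sq,
    Complex.normSq_apply]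
  congr 1
  push_cast
  ring

/-! ### Distribution functions of sums of exponentials -/

/-- Bounds satisfied by the distribution function of a sum of `n` independent unit exponentials. -/
structure HasErlangBounds (ρ : Measure ℝ) (n : ℕ) : Prop where
  eq_zero : ∀ t ≤ 0, ρ (Set.Iio t) = 0
  lower : ∀ t, 0 < t → ENNReal.ofReal (Real.exp (-t) * (t ^ n / n.factorial)) ≤ ρ (Set.Iio t)
  upper : ∀ t, 0 < t → ρ (Set.Iio t) ≤ ENNReal.ofReal (t ^ n / n.factorial)

theorem integral_sub_pow_div_factorial (Q : ℝ) (n : ℕ) :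
    ∫ x in (0 : ℝ)..Q, (Q - x) ^ n / n.factorial = Q ^ (n + 1) / (n + 1).factorial := by
  rw [intervalIntegral.integral_comp_sub_left (fun x => x ^ n / (n.factorial : ℝ)) Q]
  simp only [sub_self, sub_zero, intervalIntegral.integral_div, integral_pow]
  rw [Nat.factorial_succ]
  push_cast
  field_simp
  simp

theorem setLIntegral_sub_pow_div_factorial {Q a : ℝ} (hQ : 0 < Q) (ha : 0 ≤ a) (n : ℕ) :
    ∫⁻ x in Set.Ioo 0 Q, ENNReal.ofReal (a * ((Q - x) ^ n / n.factorial)) =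
      ENNReal.ofReal (a * (Q ^ (n + 1) / (n + 1).factorial)) := by
  have hc : Continuous fun x : ℝ => a * ((Q - x) ^ n / n.factorial) := by fun_prop
  rw [← ofReal_integral_eq_lintegral_ofReal
    ((hc.integrableOn_Icc (a := 0) (b := Q)).mono_set Set.Ioo_subset_Icc_self),
    ← integral_Ioc_eq_integral_Ioo, ← intervalIntegral.integral_of_le hQ.le,
    intervalIntegral.integral_const_mul, integral_sub_pow_div_factorial]
  refine (ae_restrict_mem measurableSet_Ioo).mono fun x hx => ?_
  have : 0 ≤ Q - x := by linarith [hx.2]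
  simp only [Pi.zero_apply]
  positivity

theorem expLaw_prod_apply (ρ : Measure ℝ) [SFinite ρ] {c : ℝ} (hc : 0 < c) (Q : ℝ) :
    (expLaw.prod ρ) {p : ℝ × ℝ | p.2 / c + p.1 < Q} =
      ∫⁻ x in Set.Ioi 0, ENNReal.ofReal (Real.exp (-x)) * ρ (Set.Iio (c * (Q - x))) := by
  have hm : MeasurableSet {p : ℝ × ℝ | p.2 / c + p.1 < Q} :=
    measurableSet_lt (by fun_prop) (by fun_prop)
  have hs : ∀ x : ℝ, Prod.mk x ⁻¹' {p : ℝ × ℝ | p.2 / c + p.1 < Q} = Set.Iio (c * (Q - x)) := by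
    intro x
    ext y
    simp only [Set.mem_preimage, Set.mem_ofPred_eq, Set.mem_Iio]
    rw [← lt_sub_iff_add_lt, div_lt_iff₀' hc]
  have hmeas := measurable_measure_prodMk_left (ν := ρ) hm
  rw [Measure.prod_apply hm]
  simp only [hs] at hmeas ⊢
  exact lintegral_expLaw _ hmeas

/-- Only `x < Q` contributes, since otherwise the threshold `c * (Q - x)` is nonpositive. -/
theorem HasErlangBounds.prod_eq_Ioo {ρ : Measure ℝ} [SFinite ρ] {n : ℕ} (h : HasErlangBounds ρ n)
    {c : ℝ} (hc : 0 < c) (Q : ℝ) :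
    (expLaw.prod ρ) {p : ℝ × ℝ | p.2 / c + p.1 < Q} =
      ∫⁻ x in Set.Ioo 0 Q, ENNReal.ofReal (Real.exp (-x)) * ρ (Set.Iio (c * (Q - x))) := by
  rw [expLaw_prod_apply ρ hc]
  rw [← Set.Ioi_inter_Iio, ← lintegral_inter_add_sdiff _ (Set.Ioi 0) (measurableSet_Iio (a := Q))]
  refine (congrArg _ (setLIntegral_eq_zero (measurableSet_Ioi.diff measurableSet_Iio)
    fun x hx => ?_)).trans (add_zero _)
  have hQx : Q ≤ x := not_lt.1 hx.2
  simp only [Pi.zero_apply]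
  rw [h.eq_zero _ (mul_nonpos_of_nonneg_of_nonpos hc.le (by linarith)), mul_zero]

theorem HasErlangBounds.prod_le {ρ : Measure ℝ} [SFinite ρ] {n : ℕ} (h : HasErlangBounds ρ n)
    {c Q : ℝ} (hc : 0 < c) (hQ : 0 < Q) :
    (expLaw.prod ρ) {p : ℝ × ℝ | p.2 / c + p.1 < Q} ≤
      ENNReal.ofReal (c ^ n * (Q ^ (n + 1) / (n + 1).factorial)) := by
  rw [h.prod_eq_Ioo hc, ← setLIntegral_sub_pow_div_factorial hQ (by positivity)]
  refine setLIntegral_mono' measurableSet_Ioo fun x hx => ?_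
  have hx2 : 0 < Q - x := by linarith [hx.2]
  calc ENNReal.ofReal (Real.exp (-x)) * ρ (Set.Iio (c * (Q - x)))
      ≤ 1 * ENNReal.ofReal ((c * (Q - x)) ^ n / n.factorial) := by
        gcongr
        · exact ENNReal.ofReal_le_one.2 (Real.exp_le_one_iff.2 (by linarith [hx.1]))
        · exact h.upper _ (by positivity)
    _ = ENNReal.ofReal (c ^ n * ((Q - x) ^ n / n.factorial)) := by
        rw [one_mul, mul_pow, mul_div_assoc]

theorem HasErlangBounds.le_prod {ρ : Measure ℝ} [SFinite ρ] {n : ℕ} (h : HasErlangBounds ρ n)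
    {c Q : ℝ} (hc : 1 ≤ c) (hQ : 0 < Q) :
    ENNReal.ofReal (Real.exp (-(c * Q)) * c ^ n * (Q ^ (n + 1) / (n + 1).factorial)) ≤
      (expLaw.prod ρ) {p : ℝ × ℝ | p.2 / c + p.1 < Q} := by
  have hc0 : 0 < c := by linarith
  rw [h.prod_eq_Ioo hc0, ← setLIntegral_sub_pow_div_factorial hQ (by positivity)]
  refine setLIntegral_mono' measurableSet_Ioo fun x hx => ?_
  have hx1 : 0 < x := hx.1
  have hx2 : 0 < Q - x := by linarith [hx.2]
  refine le_trans ?_ (mul_le_mul_right (h.lower _ (mul_pos hc0 hx2)) _)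
  rw [← ENNReal.ofReal_mul (Real.exp_pos _).le, ← mul_assoc, ← Real.exp_add, mul_pow, mul_div_assoc,
    ← mul_assoc]
  refine ENNReal.ofReal_le_ofReal ?_
  gcongr
  -- The exponents add up to `x + c * (Q - x)`, which is at most `c * Q` because `1 ≤ c` and `0 <
  -- x`.
  nlinarith

/-- The case `c = 1` of the two product estimates: the bounds are stable under adding an independent
exponential. -/
theorem HasErlangBounds.map_add {ρ : Measure ℝ} [SFinite ρ] {n : ℕ} (h : HasErlangBounds ρ n) :
    HasErlangBounds (Measure.map (fun p : ℝ × ℝ => p.2 + p.1) (expLaw.prod ρ)) (n + 1) := by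
  have hmap : ∀ t : ℝ, Measure.map (fun p : ℝ × ℝ => p.2 + p.1) (expLaw.prod ρ) (Set.Iio t) =
      (expLaw.prod ρ) {p : ℝ × ℝ | p.2 / 1 + p.1 < t} := by
    intro t
    rw [Measure.map_apply (by fun_prop) measurableSet_Iio]
    simp only [div_one]
    rfl
  refine ⟨fun t ht => ?_, fun t ht => ?_, fun t ht => ?_⟩
  · rw [hmap, h.prod_eq_Ioo one_pos, Set.Ioo_eq_empty (not_lt.2 ht)]
    simp
  · rw [hmap]
    simpa using h.le_prod le_rfl ht
  · rw [hmap]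
    simpa using h.prod_le one_pos ht

theorem hasErlangBounds_sum {ι : Type*} [Fintype ι] (T : Finset ι) :
    HasErlangBounds (Measure.map (fun e : ι → ℝ => ∑ i ∈ T, e i)
      (Measure.pi fun _ : ι => expLaw)) T.card := by
  classical
  induction T using Finset.induction_on with
  | empty =>
    simp only [Finset.sum_empty, Measure.map_const, measure_univ, one_smul, Finset.card_empty]
    refine ⟨fun t ht => ?_, fun t ht => ?_, fun t ht => ?_⟩
    · rw [Measure.dirac_apply' _ measurableSet_Iio]
      simp [ht]
    · rw [Measure.dirac_apply' _ measurableSet_Iio]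
      simp [ht, ht.le]
    · rw [Measure.dirac_apply' _ measurableSet_Iio]
      simp [ht]
  | insert a T ha ih =>
    have hind : iIndepFun (fun (i : ι) (e : ι → ℝ) => e i) (Measure.pi fun _ : ι => expLaw) :=
      iIndepFun_pi (X := fun _ : ι => (id : ℝ → ℝ)) fun _ => aemeasurable_id
    have h2 := (hind.indepFun_finsetSum_of_notMem (fun i => measurable_pi_apply i) ha).symm
    rw [indepFun_iff_map_prod_eq_prod_map_map (measurable_pi_apply a).aemeasurable (by fun_prop),
      (measurePreserving_eval (fun _ : ι => expLaw) a).map_eq] at h2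
    have hS : SFinite (Measure.map (fun e : ι → ℝ => ∑ i ∈ T, e i)
      (Measure.pi fun _ : ι => expLaw)) := inferInstance
    have h3 := ih.map_add
    have hfun : (∑ j ∈ T, fun e : ι → ℝ => e j) = fun e : ι → ℝ => ∑ i ∈ T, e i := by
      ext e
      simp
    rw [hfun] at h2
    rw [← h2, Measure.map_map (by fun_prop) (by fun_prop)] at h3
    rw [Finset.card_insert_of_notMem ha]
    convert h3 using 3 with e
    simp [Finset.sum_insert ha, add_comm]

/-! ### Gaussian vectors and the zero-forcing gain -/

variable {ι : Type*} [Fintype ι]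

/-- The law of a vector of i.i.d. `CN(0,1)` random variables. -/
def complexGaussianVector (ι : Type*) [Fintype ι] : Measure (EuclideanSpace ℂ ι) :=
  Measure.map (WithLp.toLp 2) (Measure.pi fun _ : ι => complexGaussian)

instance : IsProbabilityMeasure (complexGaussianVector ι) :=
  Measure.isProbabilityMeasure_map (by fun_prop)

theorem charFun_complexGaussianVector (t : EuclideanSpace ℂ ι) :
    charFun (complexGaussianVector ι) t = Complex.exp (-(‖t‖ ^ 2 / 4 : ℝ)) := by
  rw [complexGaussianVector, charFun_pi]
  simp_rw [charFun_complexGaussian]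
  rw [← Complex.exp_sum, EuclideanSpace.norm_sq_eq, Finset.sum_div]
  push_cast
  rw [Finset.sum_neg_distrib]

theorem map_complexGaussianVector (U : EuclideanSpace ℂ ι ≃ₗᵢ[ℂ] EuclideanSpace ℂ ι) :
    Measure.map U (complexGaussianVector ι) = complexGaussianVector ι := by
  have hU : Measurable U := U.continuous.measurable
  have : IsProbabilityMeasure (Measure.map U (complexGaussianVector ι)) :=
    Measure.isProbabilityMeasure_map hU.aemeasurable
  refine Measure.ext_of_charFun (funext fun t => ?_)
  have hinner : ∀ x, inner ℝ (U x) t = inner ℝ x (U.symm t) := by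
    intro x
    -- The characteristic function uses the real inner product while `U` is a complex isometry;
    -- polarization reduces the identity to norms.
    rw [real_inner_eq_norm_add_mul_self_sub_norm_mul_self_sub_norm_mul_self_div_two,
      real_inner_eq_norm_add_mul_self_sub_norm_mul_self_sub_norm_mul_self_div_two,
      U.norm_map, U.symm.norm_map, ← U.norm_map (x + U.symm t), map_add, U.apply_symm_apply]
  have hc : Continuous fun x : EuclideanSpace ℂ ι => Complex.exp ((inner ℝ x t : ℝ) * Complex.I) := by
    fun_prop
  have h1 : charFun (Measure.map U (complexGaussianVector ι)) t =
      charFun (complexGaussianVector ι) (U.symm t) := by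
    rw [charFun_apply, integral_map hU.aemeasurable hc.aestronglyMeasurable, charFun_apply]
    simp_rw [hinner]
  rw [h1, charFun_complexGaussianVector, charFun_complexGaussianVector, U.symm.norm_map]

/-- The squared norm of the component of `x` orthogonal to `y`. -/
def orthogonalNormSq (x y : EuclideanSpace ℂ ι) : ℝ :=
  ‖x‖ ^ 2 - ‖inner ℂ y x‖ ^ 2 / ‖y‖ ^ 2

/-- A weight orthogonal to `y` sees only the component `p` of `x` orthogonal to `y`. Cauchy–Schwarz
bounds the gain by `‖p‖ ^ 2`, and `p / ‖p‖` attains it. For `y = 0` the convention `0 / 0 = 0` makes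
the formula read `‖x‖ ^ 2`, as it should. -/
theorem zfGain_eq (hι : 2 ≤ Fintype.card ι) (x y : EuclideanSpace ℂ ι) :
    zfGain x y = orthogonalNormSq x y := by
  set p := x - (inner ℂ y x / (‖y‖ : ℂ) ^ 2) • y with hp
  have hyp : inner ℂ y p = 0 := by
    rcases eq_or_ne y 0 with rfl | hy
    · simp
    · have : (‖y‖ : ℂ) ≠ 0 := by simpa using hy
      rw [hp, inner_sub_right, inner_smul_right, inner_self_eq_norm_sq_to_K]
      simp only [Complex.coe_algebraMap]
      field_simp
      simp
  have hpy : inner ℂ p y = 0 := inner_eq_zero_symm.1 hyp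
  have hx : x = p + (inner ℂ y x / (‖y‖ : ℂ) ^ 2) • y := by simp [hp]
  have hnorm : orthogonalNormSq x y = ‖p‖ ^ 2 := by
    have h1 := norm_add_sq_eq_norm_sq_add_norm_sq_of_inner_eq_zero p
      ((inner ℂ y x / (‖y‖ : ℂ) ^ 2) • y) (by rw [inner_smul_right, hpy, mul_zero])
    rw [← hx, norm_smul, norm_div, norm_pow, Complex.norm_real, norm_norm] at h1
    rw [orthogonalNormSq]
    rcases eq_or_ne y 0 with rfl | hy
    · simp only [norm_zero, ne_eq, OfNat.ofNat_ne_zero, not_false_eq_true, zero_pow, div_zero,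
        mul_zero, add_zero] at h1
      simp only [norm_zero, ne_eq, OfNat.ofNat_ne_zero, not_false_eq_true, zero_pow, div_zero,
        sub_zero]
      rw [sq, sq, h1]
    · have hy' : ‖y‖ ≠ 0 := by simpa using hy
      have h2 : ‖x‖ ^ 2 = ‖p‖ ^ 2 + ‖inner ℂ y x‖ ^ 2 / ‖y‖ ^ 2 := by
        rw [sq, h1]
        field_simp
      rw [h2]
      ring
  have hgx : ∀ g : EuclideanSpace ℂ ι, inner ℂ g y = 0 → inner ℂ g x = inner ℂ g p := by
    intro g hg
    conv_lhs => rw [hx]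
    rw [inner_add_right, inner_smul_right, hg, mul_zero, add_zero]
  have hgr := isGreatest_zfGain hι x y
  rw [hnorm]
  refine le_antisymm ?_ ?_
  · obtain ⟨g, hg1, hg2, hg3⟩ := hgr.1
    rw [hg3, hgx g hg2]
    gcongr
    simpa [hg1] using norm_inner_le_norm (𝕜 := ℂ) g p
  · rcases eq_or_ne p 0 with h0 | h0
    · obtain ⟨g, -, -, hg3⟩ := hgr.1
      rw [h0, hg3]
      simp
    · have h0' : ‖p‖ ≠ 0 := by simpa using h0
      refine hgr.2 ⟨((‖p‖⁻¹ : ℝ) : ℂ) • p, ?_, ?_, ?_⟩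
      · simp [norm_smul, h0']
      · rw [inner_smul_left, hpy, mul_zero]
      · rw [hgx _ (by rw [inner_smul_left, hpy, mul_zero]), inner_smul_left, norm_mul,
          inner_self_eq_norm_sq_to_K]
        simp
        field_simp

/-- Extend `y / ‖y‖`, placed at index `k`, to an orthonormal basis; Parseval then leaves exactly the
coordinates other than `k`. -/
theorem exists_orthonormalBasis_orthogonalNormSq [DecidableEq ι] (k : ι)
    {y : EuclideanSpace ℂ ι} (hy : y ≠ 0) :
    ∃ b : OrthonormalBasis ι ℂ (EuclideanSpace ℂ ι), ∀ x,
      orthogonalNormSq x y = ∑ i ∈ Finset.univ \ {k}, ‖b.repr x i‖ ^ 2 := by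
  have hy' : ‖y‖ ≠ 0 := by simpa using hy
  have hv : Orthonormal ℂ (Set.domRestrict {k} fun _ : ι => ((‖y‖⁻¹ : ℝ) : ℂ) • y) := by
    refine ⟨fun i => ?_, fun i j hij => absurd (Subsingleton.elim i j) hij⟩
    simp [Set.domRestrict, norm_smul, hy']
  obtain ⟨b, hb⟩ := hv.exists_orthonormalBasis_extension_of_card_eq (by simp)
  refine ⟨b, fun x => ?_⟩
  have h1 : ‖x‖ ^ 2 = ∑ i, ‖b.repr x i‖ ^ 2 := by
    rw [← b.repr.norm_map x, EuclideanSpace.norm_sq_eq]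
  have h2 : ‖b.repr x k‖ ^ 2 = ‖inner ℂ y x‖ ^ 2 / ‖y‖ ^ 2 := by
    rw [b.repr_apply_apply, hb k rfl, inner_smul_left]
    simp
    field_simp
  rw [orthogonalNormSq, h1, ← h2, Finset.sum_sdiff_eq_sub (Finset.subset_univ _),
    Finset.sum_singleton]

theorem measurable_orthogonalNormSq :
    Measurable fun p : EuclideanSpace ℂ ι × EuclideanSpace ℂ ι => orthogonalNormSq p.1 p.2 := by
  unfold orthogonalNormSq
  fun_prop

theorem map_normSq_complexGaussianVector :
    Measure.map (fun (x : EuclideanSpace ℂ ι) (i : ι) => ‖x i‖ ^ 2) (complexGaussianVector ι) =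
      Measure.pi fun _ : ι => expLaw := by
  rw [complexGaussianVector, Measure.map_map (by fun_prop) (by fun_prop)]
  have h := Measure.pi_map_pi (μ := fun _ : ι => complexGaussian)
    (f := fun (_ : ι) (z : ℂ) => ‖z‖ ^ 2)
    (hμ := fun _ => by rw [map_normSq_complexGaussian]; infer_instance) (fun _ => by fun_prop)
  simp_rw [map_normSq_complexGaussian] at h
  exact h

/-- In a basis adapted to `y` the coordinates are again i.i.d. Gaussian, and the zero-forcing
constraint removes one of them. -/
theorem hasErlangBounds_orthogonalNormSq [Nonempty ι] {y : EuclideanSpace ℂ ι} (hy : y ≠ 0) :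
    HasErlangBounds (Measure.map (fun x => orthogonalNormSq x y) (complexGaussianVector ι))
      (Fintype.card ι - 1) := by
  classical
  obtain ⟨b, hb⟩ := exists_orthonormalBasis_orthogonalNormSq (Classical.arbitrary ι) hy
  have hcard : (Finset.univ \ {Classical.arbitrary ι} : Finset ι).card = Fintype.card ι - 1 := by
    rw [Finset.card_sdiff_of_subset (Finset.subset_univ _), Finset.card_univ, Finset.card_singleton]
  have h := hasErlangBounds_sum (Finset.univ \ {Classical.arbitrary ι} : Finset ι)
  rw [← map_normSq_complexGaussianVector, ← map_complexGaussianVector b.repr,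
    Measure.map_map (by fun_prop) b.repr.continuous.measurable,
    Measure.map_map (by fun_prop) (Measurable.comp (by fun_prop) b.repr.continuous.measurable),
    hcard] at h
  simp_rw [hb]
  exact h

/-! ### Conditional outage probability for a fixed set of relays -/

section

theorem integrableOn_pow_mul_exp_neg {γs : ℝ} (hγ : 0 < γs) (n : ℕ) :
    IntegrableOn (fun a : ℝ => (1 + γs * a) ^ n * Real.exp (-a)) (Set.Ioi 0) := by
  refine integrable_of_isBigO_exp_neg (b := 1 / 2) (by norm_num) (by fun_prop) ?_
  -- The constant comes from `z ^ n / n! ≤ exp z` at `z = (1 + γs * a) / (2 * γs) = 1 / (2 * γs) + a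
  -- / 2`, which uses up half of the decay `exp (-a)`.
  refine Asymptotics.IsBigO.of_bound ((2 * γs) ^ n * n.factorial * Real.exp (1 / (2 * γs))) ?_
  filter_upwards [eventually_ge_atTop 0] with a ha
  have h1 : 0 ≤ (1 + γs * a) / (2 * γs) := by positivity
  have h2 := Real.pow_div_factorial_le_exp _ h1 n
  rw [div_pow, div_div, div_le_iff₀ (by positivity)] at h2
  have h3 : (1 + γs * a) / (2 * γs) = 1 / (2 * γs) + a / 2 := by field_simp
  rw [h3, Real.exp_add] at h2
  have h4 : Real.exp (-a) = Real.exp (-(a / 2)) * Real.exp (-(1 / 2) * a) := by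
    rw [← Real.exp_add]
    congr 1
    ring
  have h5 : Real.exp (a / 2) * Real.exp (-(a / 2)) = 1 := by
    rw [← Real.exp_add]
    simp
  rw [Real.norm_of_nonneg (by positivity), Real.norm_of_nonneg (by positivity), h4]
  calc (1 + γs * a) ^ n * (Real.exp (-(a / 2)) * Real.exp (-(1 / 2) * a))
      ≤ (Real.exp (1 / (2 * γs)) * Real.exp (a / 2) * ((2 * γs) ^ n * n.factorial)) *
        (Real.exp (-(a / 2)) * Real.exp (-(1 / 2) * a)) := by gcongr
    _ = (2 * γs) ^ n * n.factorial * Real.exp (1 / (2 * γs)) * Real.exp (-(1 / 2) * a) *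
        (Real.exp (a / 2) * Real.exp (-(a / 2))) := by ring
    _ = _ := by rw [h5, mul_one]

theorem expLaw_singleton_zero : expLaw {0} = 0 := by
  have h : expLaw ≪ (volume : Measure ℝ) :=
    (withDensity_absolutelyContinuous _ _).trans Measure.absolutelyContinuous_restrict
  exact h Real.volume_singleton

theorem complexGaussian_singleton_zero : complexGaussian {0} = 0 := by
  have h : Measure.map (fun z : ℂ => ‖z‖ ^ 2) complexGaussian {0} = 0 := by
    rw [map_normSq_complexGaussian, expLaw_singleton_zero]
  rw [Measure.map_apply (by fun_prop) (measurableSet_singleton _)] at h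
  refine measure_mono_null ?_ h
  rintro z rfl
  simp

variable {ι : Type*} [Fintype ι]

/-- Discards the degenerate secondary channel, for which zero-forcing would cost no degree of
freedom. -/
theorem ae_ne_zero_complexGaussianVector [Nonempty ι] :
    ∀ᵐ y ∂complexGaussianVector ι, y ≠ 0 := by
  have h1 : ∀ᵐ z ∂complexGaussian, z ≠ 0 := by
    rw [ae_iff]
    simpa using complexGaussian_singleton_zero
  have h2 : ∀ᵐ y : ι → ℂ ∂(Measure.pi fun _ : ι => complexGaussian),
      y (Classical.arbitrary ι) ≠ 0 :=
    (measurePreserving_eval (fun _ : ι => complexGaussian)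
      (Classical.arbitrary ι)).quasiMeasurePreserving.ae h1
  rw [complexGaussianVector, ae_map_iff (by fun_prop) (by measurability)]
  filter_upwards [h2] with y hy h0
  exact hy (by simpa using congrArg (fun u : EuclideanSpace ℂ ι => u (Classical.arbitrary ι)) h0)

/-- The realizations of (relay to secondary destination, interference), (direct, relay to primary
destination) channels for which the combined signal is below the level `Q`. -/
def relayOutageSet (ι : Type*) [Fintype ι] (γs Q : ℝ) :
    Set ((EuclideanSpace ℂ ι × ℂ) × (ℂ × EuclideanSpace ℂ ι)) :=
  {q | zfGain q.2.2 q.1.1 / (1 + γs * ‖q.1.2‖ ^ 2) + ‖q.2.1‖ ^ 2 < Q}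

/-- The joint law of the channels in `relayOutageSet`. -/
def relayLaw (ι : Type*) [Fintype ι] :
    Measure ((EuclideanSpace ℂ ι × ℂ) × (ℂ × EuclideanSpace ℂ ι)) :=
  ((complexGaussianVector ι).prod complexGaussian).prod
    (complexGaussian.prod (complexGaussianVector ι))

instance : IsProbabilityMeasure (relayLaw ι) := by
  unfold relayLaw
  infer_instance

theorem measurableSet_relayOutageSet (hι : 2 ≤ Fintype.card ι) (γs Q : ℝ) :
    MeasurableSet (relayOutageSet ι γs Q) := by
  have h0 : Measurable fun q : (EuclideanSpace ℂ ι × ℂ) × (ℂ × EuclideanSpace ℂ ι) =>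
      (q.2.2, q.1.1) := by fun_prop
  have h : Measurable fun q : (EuclideanSpace ℂ ι × ℂ) × (ℂ × EuclideanSpace ℂ ι) =>
      orthogonalNormSq q.2.2 q.1.1 := by
    have := measurable_orthogonalNormSq.comp h0
    exact this
  have h1 : Measurable fun q : (EuclideanSpace ℂ ι × ℂ) × (ℂ × EuclideanSpace ℂ ι) =>
      ‖q.1.2‖ ^ 2 := by fun_prop
  have h2 : Measurable fun q : (EuclideanSpace ℂ ι × ℂ) × (ℂ × EuclideanSpace ℂ ι) =>
      ‖q.2.1‖ ^ 2 := by fun_prop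
  have h3 := (h.div ((h1.const_mul γs).const_add 1)).add h2
  have hs : relayOutageSet ι γs Q = (fun q : (EuclideanSpace ℂ ι × ℂ) × (ℂ × EuclideanSpace ℂ ι) =>
      orthogonalNormSq q.2.2 q.1.1 / (1 + γs * ‖q.1.2‖ ^ 2) + ‖q.2.1‖ ^ 2) ⁻¹' Set.Iio Q := by
    ext q
    rw [relayOutageSet, Set.mem_ofPred_eq, zfGain_eq hι, Set.mem_preimage, Set.mem_Iio]
  rw [hs]
  exact h3 measurableSet_Iio

/-- With the secondary channel and the interference frozen in `p`, the direct power and the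
zero-forcing gain are independent, so the product estimates apply with `c = 1 + γs * ‖p.2‖ ^ 2`. -/
theorem relayLaw_section_eq (hι : 2 ≤ Fintype.card ι) (γs Q : ℝ) (p : EuclideanSpace ℂ ι × ℂ) :
    (complexGaussian.prod (complexGaussianVector ι)) (Prod.mk p ⁻¹' relayOutageSet ι γs Q) =
      (expLaw.prod (Measure.map (fun x => orthogonalNormSq x p.1) (complexGaussianVector ι)))
        {r : ℝ × ℝ | r.2 / (1 + γs * ‖p.2‖ ^ 2) + r.1 < Q} := by
  have hm : Measurable fun x : EuclideanSpace ℂ ι => orthogonalNormSq x p.1 :=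
    measurable_orthogonalNormSq.comp (f := fun x => (x, p.1)) (by fun_prop)
  rw [← map_normSq_complexGaussian, Measure.map_prod_map _ _ (by fun_prop) hm,
    Measure.map_apply (by fun_prop) (measurableSet_lt (by fun_prop) (by fun_prop))]
  congr 1
  ext q
  simp [relayOutageSet, zfGain_eq hι]

theorem lintegral_prod_complexGaussian (g : ℝ → ℝ≥0∞) (hg : Measurable g) :
    ∫⁻ p : EuclideanSpace ℂ ι × ℂ, g (‖p.2‖ ^ 2)
      ∂((complexGaussianVector ι).prod complexGaussian) =
      ∫⁻ a in Set.Ioi 0, ENNReal.ofReal (Real.exp (-a)) * g a := by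
  have hm : Measurable fun p : EuclideanSpace ℂ ι × ℂ => g (‖p.2‖ ^ 2) := hg.comp (by fun_prop)
  rw [lintegral_prod _ hm.aemeasurable]
  simp only [lintegral_const, measure_univ, mul_one]
  rw [lintegral_complexGaussian_normSq g hg, lintegral_expLaw g hg]

theorem relayLaw_relayOutageSet_le (hι : 2 ≤ Fintype.card ι) {γs Q : ℝ} (hγ : 0 < γs)
    (hQ : 0 < Q) :
    (relayLaw ι).real (relayOutageSet ι γs Q) ≤
      (∫ a in Set.Ioi (0 : ℝ), (1 + γs * a) ^ (Fintype.card ι - 1) * Real.exp (-a)) *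
        (Q ^ Fintype.card ι / (Fintype.card ι).factorial) := by
  have : Nonempty ι := Fintype.card_pos_iff.1 (by omega)
  have hcard : Fintype.card ι - 1 + 1 = Fintype.card ι := by omega
  have hnn : 0 ≤ ∫ a in Set.Ioi (0 : ℝ),
      (1 + γs * a) ^ (Fintype.card ι - 1) * Real.exp (-a) *
        (Q ^ Fintype.card ι / (Fintype.card ι).factorial) :=
    setIntegral_nonneg measurableSet_Ioi fun a ha => by
      have : (0 : ℝ) < a := ha
      positivity
  rw [← integral_mul_const]
  refine ENNReal.toReal_le_of_le_ofReal hnn ?_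
  rw [ofReal_integral_eq_lintegral_ofReal ((integrableOn_pow_mul_exp_neg hγ _).mul_const _)
    ((ae_restrict_mem measurableSet_Ioi).mono fun a ha => by
      have : (0 : ℝ) < a := ha
      simp only [Pi.zero_apply]
      positivity), relayLaw, Measure.prod_apply (measurableSet_relayOutageSet hι γs Q)]
  calc _ ≤ ∫⁻ p : EuclideanSpace ℂ ι × ℂ, ENNReal.ofReal
        ((1 + γs * ‖p.2‖ ^ 2) ^ (Fintype.card ι - 1) *
          (Q ^ Fintype.card ι / (Fintype.card ι).factorial))
        ∂((complexGaussianVector ι).prod complexGaussian) := by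
        refine lintegral_mono_ae ?_
        filter_upwards [Measure.quasiMeasurePreserving_fst.ae ae_ne_zero_complexGaussianVector]
          with p hp
        rw [relayLaw_section_eq hι]
        have := (hasErlangBounds_orthogonalNormSq hp).prod_le
          (c := 1 + γs * ‖p.2‖ ^ 2) (by positivity) hQ
        rwa [hcard] at this
    _ = _ := by
        rw [lintegral_prod_complexGaussian (fun a => ENNReal.ofReal
          ((1 + γs * a) ^ (Fintype.card ι - 1) *
          (Q ^ Fintype.card ι / (Fintype.card ι).factorial))) (by fun_prop)]
        refine lintegral_congr fun a => ?_
        rw [← ENNReal.ofReal_mul (Real.exp_pos _).le]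
        congr 1
        ring

theorem le_relayLaw_relayOutageSet (hι : 2 ≤ Fintype.card ι) {γs Q : ℝ} (hγ : 0 < γs)
    (hQ : 0 < Q) :
    (∫ a in Set.Ioi (0 : ℝ), Real.exp (-((1 + γs * a) * Q)) *
        ((1 + γs * a) ^ (Fintype.card ι - 1) * Real.exp (-a))) *
        (Q ^ Fintype.card ι / (Fintype.card ι).factorial) ≤
      (relayLaw ι).real (relayOutageSet ι γs Q) := by
  have : Nonempty ι := Fintype.card_pos_iff.1 (by omega)
  have hcard : Fintype.card ι - 1 + 1 = Fintype.card ι := by omega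
  have hint : IntegrableOn (fun a : ℝ => Real.exp (-((1 + γs * a) * Q)) *
      ((1 + γs * a) ^ (Fintype.card ι - 1) * Real.exp (-a))) (Set.Ioi 0) := by
    refine (integrableOn_pow_mul_exp_neg hγ (Fintype.card ι - 1)).mono'
      (by fun_prop) ((ae_restrict_mem measurableSet_Ioi).mono fun a ha => ?_)
    have ha' : (0 : ℝ) < a := ha
    rw [Real.norm_of_nonneg (by positivity)]
    refine mul_le_of_le_one_left (by positivity) (Real.exp_le_one_iff.2 ?_)
    have : 0 < (1 + γs * a) * Q := by positivity
    linarith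
  rw [← integral_mul_const]
  refine (ENNReal.ofReal_le_iff_le_toReal (measure_ne_top _ _)).1 ?_
  rw [ofReal_integral_eq_lintegral_ofReal (hint.mul_const _)
    ((ae_restrict_mem measurableSet_Ioi).mono fun a ha => by
      have : (0 : ℝ) < a := ha
      simp only [Pi.zero_apply]
      positivity), relayLaw, Measure.prod_apply (measurableSet_relayOutageSet hι γs Q)]
  calc _ = ∫⁻ p : EuclideanSpace ℂ ι × ℂ, ENNReal.ofReal
        (Real.exp (-((1 + γs * ‖p.2‖ ^ 2) * Q)) * (1 + γs * ‖p.2‖ ^ 2) ^ (Fintype.card ι - 1) *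
          (Q ^ Fintype.card ι / (Fintype.card ι).factorial))
        ∂((complexGaussianVector ι).prod complexGaussian) := by
        rw [lintegral_prod_complexGaussian (fun a => ENNReal.ofReal
          (Real.exp (-((1 + γs * a) * Q)) * (1 + γs * a) ^ (Fintype.card ι - 1) *
          (Q ^ Fintype.card ι / (Fintype.card ι).factorial))) (by fun_prop)]
        refine lintegral_congr fun a => ?_
        rw [← ENNReal.ofReal_mul (Real.exp_pos _).le]
        congr 1
        ring
    _ ≤ _ := by
        refine lintegral_mono_ae ?_
        filter_upwards [Measure.quasiMeasurePreserving_fst.ae ae_ne_zero_complexGaussianVector]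
          with p hp
        rw [relayLaw_section_eq hι]
        have := (hasErlangBounds_orthogonalNormSq hp).le_prod
          (c := 1 + γs * ‖p.2‖ ^ 2) (le_add_of_nonneg_right (by positivity)) hQ
        rwa [hcard] at this

/-- The two bounds differ only by `exp (-((1 + γs * a) * Q))` inside the integral, which tends to
`1` and is dominated by `1`. -/
theorem tendsto_relayLaw_relayOutageSet (hι : 2 ≤ Fintype.card ι) {γs : ℝ} (hγ : 0 < γs) :
    Tendsto (fun Q => (relayLaw ι).real (relayOutageSet ι γs Q) / Q ^ Fintype.card ι) (𝓝[>] 0)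
      (𝓝 (1 / ((Fintype.card ι).factorial : ℝ) *
        ∫ a in Set.Ioi (0 : ℝ), (1 + γs * a) ^ (Fintype.card ι - 1) * Real.exp (-a))) := by
  set n := Fintype.card ι - 1
  have hlim : Tendsto (fun Q : ℝ => ∫ a in Set.Ioi (0 : ℝ), Real.exp (-((1 + γs * a) * Q)) *
      ((1 + γs * a) ^ n * Real.exp (-a))) (𝓝[>] 0)
      (𝓝 (∫ a in Set.Ioi (0 : ℝ), (1 + γs * a) ^ n * Real.exp (-a))) := by
    refine tendsto_integral_filter_of_dominated_convergence
      (fun a => (1 + γs * a) ^ n * Real.exp (-a)) (Eventually.of_forall fun Q => by fun_prop) ?_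
      (integrableOn_pow_mul_exp_neg hγ n) (ae_of_all _ fun a => ?_)
    · filter_upwards [self_mem_nhdsWithin] with Q hQ
      refine (ae_restrict_mem measurableSet_Ioi).mono fun a ha => ?_
      have ha' : (0 : ℝ) < a := ha
      have hQ' : (0 : ℝ) < Q := hQ
      rw [Real.norm_of_nonneg (by positivity)]
      refine mul_le_of_le_one_left (by positivity) (Real.exp_le_one_iff.2 ?_)
      have : 0 < (1 + γs * a) * Q := by positivity
      linarith
    · have hc : Continuous fun Q : ℝ => Real.exp (-((1 + γs * a) * Q)) *
          ((1 + γs * a) ^ n * Real.exp (-a)) := by fun_prop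
      simpa using (hc.tendsto 0).mono_left nhdsWithin_le_nhds
  refine tendsto_of_tendsto_of_tendsto_of_le_of_le'
    (hlim.const_mul (1 / ((Fintype.card ι).factorial : ℝ))) tendsto_const_nhds ?_ ?_
  · filter_upwards [self_mem_nhdsWithin] with Q hQ
    have hQ' : (0 : ℝ) < Q := hQ
    rw [le_div_iff₀ (by positivity)]
    refine le_trans (le_of_eq ?_) (le_relayLaw_relayOutageSet hι hγ hQ')
    ring
  · filter_upwards [self_mem_nhdsWithin] with Q hQ
    have hQ' : (0 : ℝ) < Q := hQ
    rw [div_le_iff₀ (by positivity)]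
    refine (relayLaw_relayOutageSet_le hι hγ hQ').trans (le_of_eq ?_)
    ring

end

/-! ### Decomposition of the outage event over decoding sets -/

section

/-- Labels of the channels that matter for the outage event when the relays in `S` decode. -/
abbrev ChannelIndex {M : ℕ} (v : Fin M) (S : Finset (Fin M)) : Type :=
  {k : Fin M // k ≠ v} ⊕ ((S ⊕ Unit) ⊕ (Unit ⊕ S))

/-- The link carrying a label. -/
def ChannelIndex.toLink {M : ℕ} (v : Fin M) (S : Finset (Fin M)) :
    ChannelIndex v S → {l : Tx M × Rx M // IsLink v l.1 l.2}
  | .inl k => ⟨(.primary, .secondary k), k.2⟩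
  | .inr (.inl (.inl k)) => ⟨(.secondary k, .secondaryDest), trivial⟩
  | .inr (.inl (.inr _)) => ⟨(.secondary v, .primaryDest), trivial⟩
  | .inr (.inr (.inl _)) => ⟨(.primary, .primaryDest), trivial⟩
  | .inr (.inr (.inr k)) => ⟨(.secondary k, .primaryDest), trivial⟩

/-- Lets independence restrict to the labelled links. The only possible collision is the
interference link of `v` with a relay link to the primary destination, excluded by `v ∉ S`. -/
theorem ChannelIndex.toLink_injective {M : ℕ} {v : Fin M} {S : Finset (Fin M)} (hv : v ∉ S) :
    Function.Injective (ChannelIndex.toLink v S) := by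
  have hne : ∀ k : S, (k : Fin M) ≠ v := fun k hk => hv (hk ▸ k.2)
  have hne' : ∀ k : S, v ≠ (k : Fin M) := fun k => (hne k).symm
  rintro (a | (a | a) | (a | a)) (b | (b | b) | (b | b)) hab <;>
    replace hab := congrArg Subtype.val hab <;>
    simp only [ChannelIndex.toLink, Prod.mk.injEq, Tx.secondary.injEq,
      Rx.secondary.injEq, reduceCtorEq, and_true, and_false, true_and] at hab <;>
    first
    | rfl
    | exact absurd hab (hne _)
    | exact absurd hab (hne' _)
    | rw [Subtype.ext hab]

/-- Group the channels into those from the primary source to the relays and the others. -/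
def groupChannels {M : ℕ} (v : Fin M) (S : Finset (Fin M)) (z : ChannelIndex v S → ℂ) :
    ({k : Fin M // k ≠ v} → ℂ) × ((EuclideanSpace ℂ S × ℂ) × (ℂ × EuclideanSpace ℂ S)) :=
  (fun k => z (.inl k), ((WithLp.toLp 2 fun k => z (.inr (.inl (.inl k))),
    z (.inr (.inl (.inr ())))), (z (.inr (.inr (.inl ()))),
    WithLp.toLp 2 fun k => z (.inr (.inr (.inr k))))))

theorem measurePreserving_toLp (ι : Type*) [Fintype ι] :
    MeasurePreserving (WithLp.toLp 2 : (ι → ℂ) → EuclideanSpace ℂ ι)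
      (Measure.pi fun _ : ι => complexGaussian) (complexGaussianVector ι) :=
  ⟨by fun_prop, rfl⟩

theorem measurePreserving_groupChannels {M : ℕ} (v : Fin M) (S : Finset (Fin M)) :
    MeasurePreserving (groupChannels v S) (Measure.pi fun _ : ChannelIndex v S => complexGaussian)
      ((Measure.pi fun _ : {k : Fin M // k ≠ v} => complexGaussian).prod (relayLaw S)) := by
  have hU : MeasurePreserving (fun z : Unit → ℂ => z ()) (Measure.pi fun _ => complexGaussian)
      complexGaussian := measurePreserving_eval (fun _ : Unit => complexGaussian) ()
  have hS := measurePreserving_toLp S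
  have h1 := (hS.prod hU).comp
    (measurePreserving_sumPiEquivProdPi fun _ : S ⊕ Unit => complexGaussian)
  have h2 := (hU.prod hS).comp
    (measurePreserving_sumPiEquivProdPi fun _ : Unit ⊕ S => complexGaussian)
  have h3 := (h1.prod h2).comp
    (measurePreserving_sumPiEquivProdPi fun _ : (S ⊕ Unit) ⊕ (Unit ⊕ S) => complexGaussian)
  exact ((MeasurePreserving.id (Measure.pi fun _ : {k : Fin M // k ≠ v} => complexGaussian)).prod
    h3).comp (measurePreserving_sumPiEquivProdPi fun _ : ChannelIndex v S => complexGaussian)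

variable {Ω : Type*} {M : ℕ} {v : Fin M} {h : Tx M → Rx M → Ω → ℂ}

/-- The realization of the channels that matter when the relays in `S` decode. -/
def channels (v : Fin M) (h : Tx M → Rx M → Ω → ℂ) (S : Finset (Fin M)) (x : Ω) :
    ({k : Fin M // k ≠ v} → ℂ) × ((EuclideanSpace ℂ S × ℂ) × (ℂ × EuclideanSpace ℂ S)) :=
  (fun k => h .primary (.secondary k) x,
    ((relayVector h S .secondaryDest x, h (.secondary v) .primaryDest x),
      (h .primary .primaryDest x, relayVector h S .primaryDest x)))

theorem IsRayleighFading.hasLaw_channels [MeasurableSpace Ω] {μ : Measure Ω}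
    [IsProbabilityMeasure μ] (hh : IsRayleighFading μ v h) {S : Finset (Fin M)}
    (hv : v ∉ S) : HasLaw (channels v h S)
      ((Measure.pi fun _ : {k : Fin M // k ≠ v} => complexGaussian).prod (relayLaw S)) μ := by
  have hlaw : ∀ j : ChannelIndex v S,
      HasLaw (h (ChannelIndex.toLink v S j).1.1 (ChannelIndex.toLink v S j).1.2)
        complexGaussian μ := fun j => hh.hasLaw _ _ (ChannelIndex.toLink v S j).2
  have h1 := hh.indep.precomp (ChannelIndex.toLink_injective hv)
  rw [iIndepFun_iff_map_fun_eq_pi_map fun j => (hlaw j).aemeasurable] at h1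
  simp only [fun j => (hlaw j).map_eq] at h1
  have h2 : HasLaw (fun x (j : ChannelIndex v S) =>
      h (ChannelIndex.toLink v S j).1.1 (ChannelIndex.toLink v S j).1.2 x)
      (Measure.pi fun _ : ChannelIndex v S => complexGaussian) μ :=
    ⟨aemeasurable_pi_lambda _ fun j => (hlaw j).aemeasurable, h1⟩
  have h3 := measurePreserving_groupChannels v S
  exact HasLaw.comp ⟨h3.measurable.aemeasurable, h3.map_eq⟩ h2

/-- The channels from the primary source to the relays for which the decoding set is `S`. -/
def decodingRegion (v : Fin M) (S : Finset (Fin M)) (Q : ℝ) : Set ({k : Fin M // k ≠ v} → ℂ) :=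
  Set.univ.pi fun k => {z | (k : Fin M) ∈ S ↔ Q ≤ ‖z‖ ^ 2}

/-- The outage region for the remaining channels when the decoding set is `S`. -/
def outageRegion (S : Finset (Fin M)) (γs Q : ℝ) :
    Set ((EuclideanSpace ℂ S × ℂ) × (ℂ × EuclideanSpace ℂ S)) :=
  if 2 ≤ S.card then relayOutageSet S γs Q else {q | ‖q.2.1‖ ^ 2 < Q}

theorem measurableSet_decodingRegion (v : Fin M) (S : Finset (Fin M)) (Q : ℝ) :
    MeasurableSet (decodingRegion v S Q) := by
  refine MeasurableSet.univ_pi fun k => ?_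
  have h1 : MeasurableSet {z : ℂ | Q ≤ ‖z‖ ^ 2} := measurableSet_le (by fun_prop) (by fun_prop)
  by_cases hk : (k : Fin M) ∈ S
  · simpa [hk] using h1
  · convert h1.compl using 1
    ext z
    simp [hk]

theorem measurableSet_outageRegion (S : Finset (Fin M)) (γs Q : ℝ) :
    MeasurableSet (outageRegion S γs Q) := by
  unfold outageRegion
  split_ifs with hS
  · exact measurableSet_relayOutageSet (by simpa using hS) γs Q
  · exact measurableSet_lt (by fun_prop) (by fun_prop)

/-- Every rate condition becomes a threshold at the one level `Q`. -/
theorem le_logb_iff_outageScale_le {γ R s : ℝ} (hγ : 0 < γ) (hs : 0 ≤ s) :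
    2 * R ≤ Real.logb 2 (1 + γ * s) ↔ outageScale γ R ≤ s := by
  rw [Real.le_logb_iff_rpow_le one_lt_two (by positivity), outageScale, div_le_iff₀ hγ]
  constructor <;> intro h <;> linarith

theorem mem_decodingRegion_iff {γ R : ℝ} (hγ : 0 < γ) {S : Finset (Fin M)} (hv : v ∉ S) (x : Ω) :
    (channels v h S x).1 ∈ decodingRegion v S (outageScale γ R) ↔ decodingSet v h γ R x = S := by
  simp only [decodingRegion, channels, Set.mem_univ_pi, Set.mem_ofPred_eq, Subtype.forall,
    decodingSet, Finset.ext_iff, Finset.mem_filter, Finset.mem_univ, true_and]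
  refine forall_congr' fun k => ?_
  rw [le_logb_iff_outageScale_le hγ (by positivity)]
  by_cases hk : k = v
  · subst hk
    simp [hv]
  · simp [hk, iff_comm]

theorem zfGain_nonneg {ι : Type*} [Fintype ι] (x y : EuclideanSpace ℂ ι) : 0 ≤ zfGain x y := by
  refine Real.sSup_nonneg ?_
  rintro a ⟨g, -, -, rfl⟩
  positivity

theorem mem_outageRegion_iff {N₀ Ps γ R : ℝ} (hN₀ : 0 < N₀) (hPs : 0 < Ps) (hγ : 0 < γ)
    (S : Finset (Fin M)) (x : Ω) :
    (channels v h S x).2 ∈ outageRegion S (Ps / N₀) (outageScale γ R) ↔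
      (2 ≤ S.card ∧ Real.logb 2 (1 + (relaySINR v h N₀ (γ * N₀) Ps S x
        + directSNR h N₀ (γ * N₀) x)) < 2 * R) ∨
      (S.card < 2 ∧ Real.logb 2 (1 + directSNR h N₀ (γ * N₀) x) < 2 * R) := by
  have hd : directSNR h N₀ (γ * N₀) x = γ * ‖h .primary .primaryDest x‖ ^ 2 := by
    rw [directSNR, mul_div_cancel_right₀ _ hN₀.ne']
  have hr : relaySINR v h N₀ (γ * N₀) Ps S x = γ *
      (zfGain (relayVector h S .primaryDest x) (relayVector h S .secondaryDest x) /
        (1 + Ps / N₀ * ‖h (.secondary v) .primaryDest x‖ ^ 2)) := by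
    have h1 : N₀ + Ps * ‖h (.secondary v) .primaryDest x‖ ^ 2 ≠ 0 := by positivity
    have h2 : 1 + Ps / N₀ * ‖h (.secondary v) .primaryDest x‖ ^ 2 ≠ 0 := by positivity
    rw [relaySINR]
    field_simp
  have hz := zfGain_nonneg (relayVector h S .primaryDest x) (relayVector h S .secondaryDest x)
  rw [hd, hr, ← mul_add, ← not_le, ← not_le (b := Real.logb 2 (1 + γ * ‖_‖ ^ 2)),
    le_logb_iff_outageScale_le hγ (by positivity), le_logb_iff_outageScale_le hγ (by positivity),
    outageRegion]
  split_ifs with hS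
  · simp [hS, relayOutageSet, channels, not_lt.2 hS]
  · simp [hS, channels, not_le.1 hS]

theorem outageEvent_eq_iUnion {N₀ Ps γ R : ℝ} (hN₀ : 0 < N₀) (hPs : 0 < Ps) (hγ : 0 < γ) :
    outageEvent v h N₀ (γ * N₀) Ps R = ⋃ S ∈ (Finset.univ.erase v).powerset,
      channels v h S ⁻¹' (decodingRegion v S (outageScale γ R) ×ˢ
        outageRegion S (Ps / N₀) (outageScale γ R)) := by
  ext x
  simp only [Set.mem_iUnion, Set.mem_preimage, Set.mem_prod, Finset.mem_powerset, exists_prop]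
  have hv : v ∉ decodingSet v h γ R x := by simp [decodingSet]
  have hx : x ∈ outageEvent v h N₀ (γ * N₀) Ps R ↔
      (channels v h (decodingSet v h γ R x) x).2 ∈
        outageRegion (decodingSet v h γ R x) (Ps / N₀) (outageScale γ R) := by
    rw [mem_outageRegion_iff hN₀ hPs hγ, outageEvent, mul_div_cancel_right₀ _ hN₀.ne']
    rfl
  rw [hx]
  constructor
  · intro hmem
    exact ⟨decodingSet v h γ R x, fun k hk => Finset.mem_erase.2
      ⟨fun hkv => hv (hkv ▸ hk), Finset.mem_univ _⟩, (mem_decodingRegion_iff hγ hv x).2 rfl, hmem⟩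
  · rintro ⟨S, hS, h1, h2⟩
    rw [mem_decodingRegion_iff hγ fun hvS => by simpa using hS hvS] at h1
    subst h1
    exact h2

/-- Probability that a unit exponential is below `Q`. -/
def expCdf (Q : ℝ) : ℝ := expLaw.real (Set.Iio Q)

theorem complexGaussian_real_lt (Q : ℝ) :
    complexGaussian.real {z | ‖z‖ ^ 2 < Q} = expCdf Q := by
  rw [expCdf, ← map_normSq_complexGaussian, map_measureReal_apply (by fun_prop) measurableSet_Iio]
  rfl

theorem complexGaussian_real_le (Q : ℝ) :
    complexGaussian.real {z | Q ≤ ‖z‖ ^ 2} = 1 - expCdf Q := by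
  rw [← complexGaussian_real_lt, ← probReal_compl_eq_one_sub
    (measurableSet_lt (by fun_prop) (by fun_prop))]
  congr 1
  ext z
  simp

theorem pi_real_decodingRegion {S : Finset (Fin M)} (hS : S ⊆ Finset.univ.erase v) (Q : ℝ) :
    (Measure.pi fun _ : {k : Fin M // k ≠ v} => complexGaussian).real (decodingRegion v S Q) =
      (1 - expCdf Q) ^ S.card * expCdf Q ^ (M - 1 - S.card) := by
  have h1 : ∀ k : Fin M, complexGaussian.real {z | k ∈ S ↔ Q ≤ ‖z‖ ^ 2} =
      if k ∈ S then 1 - expCdf Q else expCdf Q := by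
    intro k
    split_ifs with hk
    · simp [hk, complexGaussian_real_le]
    · simp [hk, complexGaussian_real_lt]
  rw [decodingRegion, measureReal_def, Measure.pi_pi, ENNReal.toReal_prod]
  simp only [← measureReal_def, h1]
  rw [← Finset.prod_subtype (Finset.univ.erase v) (by simp)
    (fun k => if k ∈ S then 1 - expCdf Q else expCdf Q), Finset.prod_ite, Finset.prod_const,
    Finset.prod_const, Finset.filter_mem_eq_inter, Finset.inter_eq_right.2 hS,
    Finset.filter_notMem_eq_sdiff, Finset.card_sdiff_of_subset hS]
  simp

theorem IsRayleighFading.outageProb_eq_sum [MeasurableSpace Ω] {μ : Measure Ω}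
    [IsProbabilityMeasure μ] (hh : IsRayleighFading μ v h) {N₀ Ps γ R : ℝ}
    (hN₀ : 0 < N₀) (hPs : 0 < Ps) (hγ : 0 < γ) :
    outageProb μ v h N₀ Ps γ R = ∑ S ∈ (Finset.univ.erase v).powerset,
      (1 - expCdf (outageScale γ R)) ^ S.card * expCdf (outageScale γ R) ^ (M - 1 - S.card) *
        (relayLaw S).real (outageRegion S (Ps / N₀) (outageScale γ R)) := by
  have hv : ∀ S ∈ (Finset.univ.erase v).powerset, v ∉ S := fun S hS hvS => by
    simpa using Finset.mem_powerset.1 hS hvS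
  have hm : ∀ S, MeasurableSet (decodingRegion v S (outageScale γ R) ×ˢ
      outageRegion S (Ps / N₀) (outageScale γ R)) := fun S =>
    (measurableSet_decodingRegion v S _).prod (measurableSet_outageRegion S _ _)
  rw [outageProb, outageEvent_eq_iUnion hN₀ hPs hγ, measureReal_biUnion_finset₀]
  · refine Finset.sum_congr rfl fun S hS => ?_
    have hlaw := hh.hasLaw_channels (hv S hS)
    rw [← pi_real_decodingRegion (Finset.mem_powerset.1 hS), ← measureReal_prod_prod,
      ← hlaw.map_eq, measureReal_def, measureReal_def,
      Measure.map_apply_of_aemeasurable hlaw.aemeasurable (hm S)]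
  · intro S hS S' hS' hne
    refine (Set.disjoint_left.2 fun x hx hx' => hne ?_).aedisjoint
    rw [← (mem_decodingRegion_iff hγ (hv S hS) x).1 hx.1,
      ← (mem_decodingRegion_iff hγ (hv S' hS') x).1 hx'.1]
  · intro S hS
    -- The channels are only a.e. measurable, hence null measurability here and a.e. disjointness
    -- above.
    exact (hh.hasLaw_channels (hv S hS)).aemeasurable.nullMeasurableSet_preimage (hm S)

end

/-! ### Behaviour of the outage probability for small `Q` -/

theorem hasErlangBounds_expLaw : HasErlangBounds expLaw 1 := by
  have h := hasErlangBounds_sum (Finset.univ : Finset Unit)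
  simpa [(measurePreserving_eval (fun _ : Unit => expLaw) ()).map_eq] using h

theorem expCdf_nonneg (Q : ℝ) : 0 ≤ expCdf Q := measureReal_nonneg

theorem expCdf_le_one (Q : ℝ) : expCdf Q ≤ 1 := measureReal_le_one

theorem expCdf_le {Q : ℝ} (hQ : 0 < Q) : expCdf Q ≤ Q := by
  have h := hasErlangBounds_expLaw.upper Q hQ
  simp only [pow_one, Nat.factorial_one, Nat.cast_one, div_one] at h
  exact ENNReal.toReal_le_of_le_ofReal hQ.le h

theorem exp_neg_mul_le_expCdf {Q : ℝ} (hQ : 0 < Q) : Real.exp (-Q) * Q ≤ expCdf Q := by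
  have h := hasErlangBounds_expLaw.lower Q hQ
  simp only [pow_one, Nat.factorial_one, Nat.cast_one, div_one] at h
  exact (ENNReal.ofReal_le_iff_le_toReal (measure_ne_top _ _)).1 h

/-- A lower bound valid for every positive `Q`, needed when `Q` does not tend to `0`. -/
theorem exp_neg_one_mul_min_le_expCdf {Q : ℝ} (hQ : 0 < Q) :
    Real.exp (-1) * min Q 1 ≤ expCdf Q := by
  have h0 : 0 < min Q 1 := lt_min hQ one_pos
  calc Real.exp (-1) * min Q 1 ≤ Real.exp (-min Q 1) * min Q 1 := by
        gcongr
        exact min_le_right _ _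
    _ ≤ expCdf (min Q 1) := exp_neg_mul_le_expCdf h0
    _ ≤ expCdf Q := measureReal_mono (Set.Iio_subset_Iio (min_le_left _ _))

theorem tendsto_expCdf : Tendsto expCdf (𝓝[>] 0) (𝓝 0) := by
  refine tendsto_of_tendsto_of_tendsto_of_le_of_le' tendsto_const_nhds
    (tendsto_id.mono_left nhdsWithin_le_nhds) (Eventually.of_forall expCdf_nonneg) ?_
  filter_upwards [self_mem_nhdsWithin] with Q hQ using expCdf_le hQ

theorem tendsto_expCdf_div : Tendsto (fun Q => expCdf Q / Q) (𝓝[>] 0) (𝓝 1) := by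
  have h1 : Tendsto (fun Q : ℝ => Real.exp (-Q)) (𝓝[>] 0) (𝓝 1) := by
    have hc : Continuous fun Q : ℝ => Real.exp (-Q) := by fun_prop
    simpa using (hc.tendsto 0).mono_left nhdsWithin_le_nhds
  refine tendsto_of_tendsto_of_tendsto_of_le_of_le' h1 tendsto_const_nhds ?_ ?_
  · filter_upwards [self_mem_nhdsWithin] with Q hQ
    exact (le_div_iff₀ hQ).2 (exp_neg_mul_le_expCdf hQ)
  · filter_upwards [self_mem_nhdsWithin] with Q hQ
    exact (div_le_one₀ hQ).2 (expCdf_le hQ)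

theorem relayLaw_real_direct (ι : Type*) [Fintype ι] (Q : ℝ) :
    (relayLaw ι).real {q | ‖q.2.1‖ ^ 2 < Q} = expCdf Q := by
  have h : MeasurePreserving (fun q : (EuclideanSpace ℂ ι × ℂ) × (ℂ × EuclideanSpace ℂ ι) => q.2.1)
      (relayLaw ι) complexGaussian := measurePreserving_fst.comp measurePreserving_snd
  rw [← complexGaussian_real_lt]
  have hm : MeasurableSet {z : ℂ | ‖z‖ ^ 2 < Q} := measurableSet_lt (by fun_prop) (by fun_prop)
  exact h.measureReal_preimage hm.nullMeasurableSet

/-- The limit of the conditional outage probability over `Q ^ K` when `K` relays decode. -/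
def conditionalCoeff (γs : ℝ) (K : ℕ) : ℝ :=
  if 2 ≤ K then 1 / (K.factorial : ℝ) *
    ∫ a in Set.Ioi (0 : ℝ), (1 + γs * a) ^ (K - 1) * Real.exp (-a)
  else K

/-- With fewer than two relays the event is direct outage, of probability `F(Q)`. Divided by `Q ^ 0`
it tends to `0` and by `Q ^ 1` to `1`, that is, to `K` in both cases. -/
theorem tendsto_relayLaw_outageRegion {M : ℕ} (S : Finset (Fin M)) {γs : ℝ} (hγ : 0 < γs) :
    Tendsto (fun Q => (relayLaw S).real (outageRegion S γs Q) / Q ^ S.card) (𝓝[>] 0)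
      (𝓝 (conditionalCoeff γs S.card)) := by
  unfold outageRegion conditionalCoeff
  by_cases hS : 2 ≤ S.card
  · simp only [hS, if_true]
    simpa using tendsto_relayLaw_relayOutageSet (ι := S) (by simpa using hS) hγ
  · simp only [hS, if_false, relayLaw_real_direct]
    obtain h | h : S.card = 0 ∨ S.card = 1 := by omega
    · simpa [h] using tendsto_expCdf
    · simpa [h] using tendsto_expCdf_div

theorem sum_conditionalCoeff {M : ℕ} (hM : 2 ≤ M) (v : Fin M) (γs : ℝ) :
    ∑ S ∈ (Finset.univ.erase v).powerset, conditionalCoeff γs S.card = outageCoeff M γs := by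
  rw [Finset.sum_powerset_apply_card, Finset.card_erase_of_mem (Finset.mem_univ v),
    Finset.card_univ, Fintype.card_fin]
  have hr : Finset.range (M - 1 + 1) = insert 0 (insert 1 (Finset.Icc 2 (M - 1))) := by
    ext k
    simp only [Finset.mem_range, Finset.mem_insert, Finset.mem_Icc]
    omega
  rw [hr, Finset.sum_insert (by simp), Finset.sum_insert (by simp), outageCoeff]
  have h1 : ∀ K ∈ Finset.Icc 2 (M - 1), (M - 1).choose K • conditionalCoeff γs K =
      ((M - 1).choose K : ℝ) * (1 / (K.factorial : ℝ)) *
      (∫ a in Set.Ioi (0 : ℝ), (1 + γs * a) ^ (K - 1) * Real.exp (-a)) := by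
    intro K hK
    rw [conditionalCoeff, if_pos (Finset.mem_Icc.1 hK).1, nsmul_eq_mul, mul_assoc]
  rw [Finset.sum_congr rfl h1]
  simp [conditionalCoeff, Nat.cast_sub (show 1 ≤ M by omega), add_comm]

/-- The outage probability as a function of `Q`. -/
def outageFun {M : ℕ} (v : Fin M) (γs Q : ℝ) : ℝ :=
  ∑ S ∈ (Finset.univ.erase v).powerset,
    (1 - expCdf Q) ^ S.card * expCdf Q ^ (M - 1 - S.card) * (relayLaw S).real (outageRegion S γs Q)

/-- Splitting `Q ^ (M - 1)` as `Q ^ (M - 1 - K) * Q ^ K` matches the relays that fail to decode with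
the conditional outage of those that do. -/
theorem tendsto_outageFun_div {M : ℕ} (hM : 2 ≤ M) (v : Fin M) {γs : ℝ} (hγ : 0 < γs) :
    Tendsto (fun Q => outageFun v γs Q / Q ^ (M - 1)) (𝓝[>] 0) (𝓝 (outageCoeff M γs)) := by
  rw [← sum_conditionalCoeff hM v]
  have hterm : ∀ S ∈ (Finset.univ.erase v).powerset,
      Tendsto (fun Q => (1 - expCdf Q) ^ S.card * (expCdf Q / Q) ^ (M - 1 - S.card) *
        ((relayLaw S).real (outageRegion S γs Q) / Q ^ S.card)) (𝓝[>] 0)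
        (𝓝 (conditionalCoeff γs S.card)) := by
    intro S _
    have h := (((tendsto_expCdf.const_sub 1).pow S.card).mul
      (tendsto_expCdf_div.pow (M - 1 - S.card))).mul (tendsto_relayLaw_outageRegion S hγ)
    simpa using h
  refine (tendsto_finsetSum _ hterm).congr' ?_
  filter_upwards [self_mem_nhdsWithin] with Q hQ
  have hQ' : (0 : ℝ) < Q := hQ
  rw [outageFun, Finset.sum_div]
  refine Finset.sum_congr rfl fun S hS => ?_
  have hcard : S.card ≤ M - 1 := by
    simpa [Finset.card_erase_of_mem] using Finset.card_le_card (Finset.mem_powerset.1 hS)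
  have hpow : Q ^ (M - 1) = Q ^ (M - 1 - S.card) * Q ^ S.card := by
    rw [← pow_add, Nat.sub_add_cancel hcard]
  rw [hpow, div_pow]
  field_simp

/-- The term of the empty decoding set: all `M - 1` relays and the direct link are below `Q`. -/
theorem expCdf_pow_le_outageFun {M : ℕ} (v : Fin M) (γs Q : ℝ) :
    expCdf Q ^ M ≤ outageFun v γs Q := by
  have hM : M - 1 + 1 = M := Nat.sub_add_cancel (Nat.one_le_of_lt v.pos)
  have h := Finset.single_le_sum
    (f := fun S : Finset (Fin M) => (1 - expCdf Q) ^ S.card * expCdf Q ^ (M - 1 - S.card) *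
      (relayLaw S).real (outageRegion S γs Q)) (s := (Finset.univ.erase v).powerset)
    (fun S _ => mul_nonneg (mul_nonneg (pow_nonneg (sub_nonneg.2 (expCdf_le_one Q)) _)
      (pow_nonneg (expCdf_nonneg Q) _)) measureReal_nonneg) (Finset.empty_mem_powerset _)
  refine le_trans (le_of_eq ?_) h
  simp [outageRegion, relayLaw_real_direct, ← pow_succ, hM]

theorem outageCoeff_pos {M : ℕ} (hM : 2 ≤ M) {γs : ℝ} (hγ : 0 < γs) : 0 < outageCoeff M γs := by
  have hM' : (2 : ℝ) ≤ M := by exact_mod_cast hM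
  refine add_pos_of_nonneg_of_pos (Finset.sum_nonneg fun K _ => ?_) (by linarith)
  refine mul_nonneg (by positivity) (setIntegral_nonneg measurableSet_Ioi fun a ha => ?_)
  have : (0 : ℝ) < a := ha
  positivity

/-! ### Rate families, multiplexing gain and diversity -/

theorem outageScale_pos {γ R : ℝ} (hγ : 0 < γ) (hR : 0 < R) : 0 < outageScale γ R :=
  div_pos (sub_pos.2 (Real.one_lt_rpow one_lt_two (by linarith))) hγ

theorem IsRateFamily.eventually_pos {R : ℝ → ℝ} (hR : IsRateFamily R) : ∀ᶠ γ in atTop, 0 < R γ := by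
  obtain ⟨R₀, h0, h1⟩ := hR
  filter_upwards [h1] with γ hγ using h0.trans_le hγ

theorem tendsto_div_log_of_bounded {f : ℝ → ℝ} {a b : ℝ} (ha : ∀ᶠ γ in atTop, a ≤ f γ)
    (hb : ∀ᶠ γ in atTop, f γ ≤ b) : Tendsto (fun γ => f γ / Real.log γ) atTop (𝓝 0) := by
  refine tendsto_of_tendsto_of_tendsto_of_le_of_le'
    (tendsto_const_nhds.div_atTop Real.tendsto_log_atTop (a := a))
    (tendsto_const_nhds.div_atTop Real.tendsto_log_atTop (a := b)) ?_ ?_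
  · filter_upwards [ha, eventually_gt_atTop 1] with γ h1 h2
    have := Real.log_pos h2
    gcongr
  · filter_upwards [hb, eventually_gt_atTop 1] with γ h1 h2
    have := Real.log_pos h2
    gcongr

/-- Here `log Q = 2R log 2 + log (1 - 2^(-2R)) - log γ`. The middle term stays bounded because `R`
is bounded away from `0`. -/
theorem tendsto_log_outageScale_div_log {R : ℝ → ℝ} {r : ℝ} (hR : IsRateFamily R)
    (hr : HasMultiplexingGain R r) :
    Tendsto (fun γ => Real.log (outageScale γ (R γ)) / Real.log γ) atTop (𝓝 (2 * r - 1)) := by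
  obtain ⟨R₀, h0, h1⟩ := hR
  have hlt : (2 : ℝ) ^ (-(2 * R₀)) < 1 := Real.rpow_lt_one_of_one_lt_of_neg one_lt_two (by linarith)
  have hle : ∀ {γ}, R₀ ≤ R γ → (2 : ℝ) ^ (-(2 * R γ)) ≤ 2 ^ (-(2 * R₀)) := fun hγ =>
    Real.rpow_le_rpow_of_exponent_le one_le_two (by linarith)
  have hb : Tendsto (fun γ => Real.log (1 - (2 : ℝ) ^ (-(2 * R γ))) / Real.log γ) atTop (𝓝 0) := by
    refine tendsto_div_log_of_bounded (a := Real.log (1 - (2 : ℝ) ^ (-(2 * R₀)))) (b := 0) ?_ ?_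
    · filter_upwards [h1] with γ hγ
      exact Real.log_le_log (by linarith) (by linarith [hle hγ])
    · filter_upwards [h1] with γ hγ
      have := hle hγ
      have := Real.rpow_pos_of_pos two_pos (-(2 * R γ))
      exact Real.log_nonpos (by linarith) (by linarith)
  have hsum := ((hr.const_mul 2).add hb).sub_const 1
  rw [add_zero] at hsum
  refine hsum.congr' ?_
  filter_upwards [h1, eventually_gt_atTop 1] with γ hγ hγ1
  have hlog := Real.log_pos hγ1
  have hlog2 : Real.log 2 ≠ 0 := (Real.log_pos one_lt_two).ne'
  have hfac : (2 : ℝ) ^ (2 * R γ) - 1 = 2 ^ (2 * R γ) * (1 - 2 ^ (-(2 * R γ))) := by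
    rw [mul_sub, ← Real.rpow_add two_pos]
    simp
  have hpos : 0 < 1 - (2 : ℝ) ^ (-(2 * R γ)) := by linarith [hle hγ]
  have hpos2 : (0 : ℝ) < 2 ^ (2 * R γ) := Real.rpow_pos_of_pos two_pos _
  rw [outageScale, Real.log_div (by rw [hfac]; positivity) (by linarith), hfac,
    Real.log_mul hpos2.ne' hpos.ne', Real.log_rpow two_pos, Real.logb]
  field_simp

section Asymptotics

variable {Ω : Type*} [MeasurableSpace Ω] {μ : Measure Ω} [IsProbabilityMeasure μ] {M : ℕ}
  {v : Fin M} {h : Tx M → Rx M → Ω → ℂ} {N₀ Ps : ℝ}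

theorem IsRayleighFading.outageProb_eq (hh : IsRayleighFading μ v h) {γ R : ℝ} (hN₀ : 0 < N₀)
    (hPs : 0 < Ps) (hγ : 0 < γ) :
    outageProb μ v h N₀ Ps γ R = outageFun v (Ps / N₀) (outageScale γ R) :=
  hh.outageProb_eq_sum hN₀ hPs hγ

theorem IsRayleighFading.tendsto_outageProb_div (hh : IsRayleighFading μ v h) (hM : 2 ≤ M)
    (hN₀ : 0 < N₀) (hPs : 0 < Ps) {R : ℝ → ℝ} (hR : ∀ᶠ γ in atTop, 0 < R γ)
    (hQ : Tendsto (fun γ : ℝ => outageScale γ (R γ)) atTop (𝓝 0)) :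
    Tendsto (fun γ : ℝ => outageProb μ v h N₀ Ps γ (R γ) / outageScale γ (R γ) ^ (M - 1))
      atTop (𝓝 (outageCoeff M (Ps / N₀))) := by
  have hQ' : Tendsto (fun γ : ℝ => outageScale γ (R γ)) atTop (𝓝[>] 0) := by
    refine tendsto_nhdsWithin_iff.2 ⟨hQ, ?_⟩
    filter_upwards [hR, eventually_gt_atTop 0] with γ h1 h2 using outageScale_pos h2 h1
  refine ((tendsto_outageFun_div hM v (div_pos hPs hN₀)).comp hQ').congr' ?_
  filter_upwards [eventually_gt_atTop 0] with γ hγ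
  rw [hh.outageProb_eq hN₀ hPs hγ, Function.comp_apply]

theorem IsRayleighFading.hasDiversity_of_lt_half (hh : IsRayleighFading μ v h) (hM : 2 ≤ M)
    (hN₀ : 0 < N₀) (hPs : 0 < Ps) {R : ℝ → ℝ} {r : ℝ} (hR : IsRateFamily R)
    (hr : HasMultiplexingGain R r) (hr2 : r < 1 / 2) :
    HasDiversity (fun γ => outageProb μ v h N₀ Ps γ (R γ)) ((1 - 2 * r) * ((M : ℝ) - 1)) := by
  have hlogQ := tendsto_log_outageScale_div_log hR hr
  have hpos : ∀ᶠ γ in atTop, 0 < outageScale γ (R γ) := by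
    filter_upwards [hR.eventually_pos, eventually_gt_atTop 0] with γ h1 h2
      using outageScale_pos h2 h1
  have hbot : Tendsto (fun γ => Real.log (outageScale γ (R γ))) atTop atBot := by
    refine (hlogQ.neg_mul_atTop (by linarith) Real.tendsto_log_atTop).congr' ?_
    filter_upwards [eventually_gt_atTop 1] with γ hγ
    exact div_mul_cancel₀ _ (Real.log_pos hγ).ne'
  have hQ : Tendsto (fun γ => outageScale γ (R γ)) atTop (𝓝 0) := by
    refine (Real.tendsto_exp_atBot.comp hbot).congr' ?_
    filter_upwards [hpos] with γ hγ using Real.exp_log hγ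
  have hC := outageCoeff_pos hM (div_pos hPs hN₀)
  have hlim := hh.tendsto_outageProb_div hM hN₀ hPs hR.eventually_pos hQ
  have h1 := (hlim.log hC.ne').div_atTop Real.tendsto_log_atTop
  have h2 := h1.add (hlogQ.const_mul ((M : ℝ) - 1))
  have hval : 0 + ((M : ℝ) - 1) * (2 * r - 1) = -((1 - 2 * r) * ((M : ℝ) - 1)) := by ring
  rw [hval] at h2
  refine h2.congr' ?_
  filter_upwards [hpos, hlim.eventually (lt_mem_nhds hC)] with γ hγ hν
  have hQpow : 0 < outageScale γ (R γ) ^ (M - 1) := by positivity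
  have hν' : outageProb μ v h N₀ Ps γ (R γ) ≠ 0 := by
    intro h0
    rw [h0, zero_div] at hν
    exact lt_irrefl _ hν
  rw [Real.log_div hν' hQpow.ne', Real.log_pow, Nat.cast_sub (by omega)]
  push_cast
  ring

theorem IsRayleighFading.hasDiversity_of_half_le (hh : IsRayleighFading μ v h)
    (hN₀ : 0 < N₀) (hPs : 0 < Ps) {R : ℝ → ℝ} {r : ℝ} (hR : IsRateFamily R)
    (hr : HasMultiplexingGain R r) (hr2 : 1 / 2 ≤ r) :
    HasDiversity (fun γ => outageProb μ v h N₀ Ps γ (R γ)) 0 := by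
  have hlogQ := tendsto_log_outageScale_div_log hR hr
  have h1 : Tendsto (fun γ : ℝ => -1 / Real.log γ) atTop (𝓝 0) :=
    tendsto_const_nhds.div_atTop Real.tendsto_log_atTop
  -- This is `log ((e⁻¹ min(Q, 1))^M) / log γ`; as `2r - 1 ≥ 0`, the minimum with `0` tends to `0`.
  have hlow := (h1.add (hlogQ.min (tendsto_const_nhds (x := (0 : ℝ))))).const_mul (M : ℝ)
  rw [min_eq_right (by linarith), add_zero, mul_zero] at hlow
  unfold HasDiversity
  rw [neg_zero]
  refine tendsto_of_tendsto_of_tendsto_of_le_of_le' hlow tendsto_const_nhds ?_ ?_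
  · filter_upwards [hR.eventually_pos, eventually_gt_atTop 1] with γ hRγ hγ
    have hQ := outageScale_pos (by linarith : 0 < γ) hRγ
    have hmin : 0 < min (outageScale γ (R γ)) 1 := lt_min hQ one_pos
    have hlog := Real.log_pos hγ
    have hlogmin : Real.log (min (outageScale γ (R γ)) 1) =
        min (Real.log (outageScale γ (R γ))) 0 := by
      rcases le_total (outageScale γ (R γ)) 1 with hle | hle
      · rw [min_eq_left hle, min_eq_left (Real.log_nonpos hQ.le hle)]
      · rw [min_eq_right hle, min_eq_right (Real.log_nonneg hle), Real.log_one]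
    have hle : (Real.exp (-1) * min (outageScale γ (R γ)) 1) ^ M ≤
        outageProb μ v h N₀ Ps γ (R γ) := by
      rw [hh.outageProb_eq hN₀ hPs (by linarith)]
      exact (pow_le_pow_left₀ (by positivity) (exp_neg_one_mul_min_le_expCdf hQ) M).trans
        (expCdf_pow_le_outageFun v _ _)
    have hloge := Real.log_le_log (by positivity) hle
    rw [Real.log_pow, Real.log_mul (Real.exp_pos _).ne' hmin.ne', Real.log_exp, hlogmin] at hloge
    rw [le_div_iff₀ hlog]
    refine le_trans (le_of_eq ?_) hloge
    rw [mul_assoc, add_mul, div_mul_cancel₀ _ hlog.ne', min_mul_of_nonneg _ _ hlog.le,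
      div_mul_cancel₀ _ hlog.ne', zero_mul]
  · filter_upwards [eventually_gt_atTop 1] with γ hγ
    exact div_nonpos_of_nonpos_of_nonneg
      (Real.log_nonpos measureReal_nonneg measureReal_le_one) (Real.log_pos hγ).le

theorem IsRayleighFading.hasDiversity (hh : IsRayleighFading μ v h) (hM : 2 ≤ M)
    (hN₀ : 0 < N₀) (hPs : 0 < Ps) {R : ℝ → ℝ} {r : ℝ} (hR : IsRateFamily R)
    (hr : HasMultiplexingGain R r) (hr2 : r ≤ 1 / 2) :
    HasDiversity (fun γ => outageProb μ v h N₀ Ps γ (R γ)) ((1 - 2 * r) * ((M : ℝ) - 1)) := by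
  rcases hr2.lt_or_eq with hlt | rfl
  · exact hh.hasDiversity_of_lt_half hM hN₀ hPs hR hr hlt
  -- At `r = 1/2` the multiplexing gain does not decide whether `Q → 0`, so the scaling law is
  -- unavailable.
  · simpa using hh.hasDiversity_of_half_le hN₀ hPs hR hr le_rfl

end Asymptotics

theorem HasDiversity.unique {ν : ℝ → ℝ} {d d' : ℝ} (hd : HasDiversity ν d)
    (hd' : HasDiversity ν d') : d = d' :=
  neg_injective (tendsto_nhds_unique hd hd')

theorem HasMultiplexingGain.nonneg {R : ℝ → ℝ} {r : ℝ} (hr : HasMultiplexingGain R r)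
    (hR : IsRateFamily R) : 0 ≤ r := by
  refine ge_of_tendsto hr ?_
  filter_upwards [hR.eventually_pos, eventually_gt_atTop 1] with γ h1 h2
  exact div_nonneg h1.le (Real.logb_nonneg one_lt_two h2.le)

theorem hasMultiplexingGain_const (c : ℝ) : HasMultiplexingGain (fun _ => c) 0 :=
  tendsto_const_nhds.div_atTop (Real.tendsto_logb_atTop one_lt_two)

theorem hasMultiplexingGain_mul_logb (r : ℝ) :
    HasMultiplexingGain (fun γ => r * Real.logb 2 γ) r := by
  refine tendsto_const_nhds.congr' ?_
  filter_upwards [eventually_gt_atTop 1] with γ hγ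
  exact (mul_div_cancel_right₀ _ (Real.logb_pos one_lt_two hγ).ne').symm

theorem isRateFamily_mul_logb {r : ℝ} (hr : 0 < r) : IsRateFamily fun γ => r * Real.logb 2 γ := by
  refine ⟨r, hr, ?_⟩
  filter_upwards [(Real.tendsto_logb_atTop one_lt_two).eventually_ge_atTop 1] with γ hγ
  exact le_mul_of_one_le_right hr.le hγ

end CognitiveRelay

end

open CognitiveRelay in
theorem mainTheorem1 {Ω : Type*} [MeasurableSpace Ω] (μ : Measure Ω) [IsProbabilityMeasure μ]
    (M : ℕ) (hM : 2 ≤ M) (v : Fin M) (h : Tx M → Rx M → Ω → ℂ) (hh : IsRayleighFading μ v h)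
    (N₀ Ps : ℝ) (hN₀ : 0 < N₀) (hPs : 0 < Ps) :
    (0 < outageCoeff M (Ps / N₀) ∧
      ∀ R : ℝ → ℝ, (∀ᶠ γ in atTop, 0 < R γ) →
        Tendsto (fun γ : ℝ => outageScale γ (R γ)) atTop (𝓝 0) →
        Tendsto (fun γ : ℝ => outageProb μ v h N₀ Ps γ (R γ) / outageScale γ (R γ) ^ (M - 1))
          atTop (𝓝 (outageCoeff M (Ps / N₀)))) ∧
    (∀ r : ℝ, 0 ≤ r → r ≤ 1 / 2 → ∀ R : ℝ → ℝ, IsRateFamily R → HasMultiplexingGain R r →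
      HasDiversity (fun γ => outageProb μ v h N₀ Ps γ (R γ)) ((1 - 2 * r) * ((M : ℝ) - 1))) ∧
    IsGreatest {d : ℝ | ∃ r : ℝ, Achieves μ v h N₀ Ps r d} ((M : ℝ) - 1) ∧
    IsLUB {r : ℝ | ∃ d : ℝ, 0 < d ∧ Achieves μ v h N₀ Ps r d} (1 / 2) := by
  have hM1 : (0 : ℝ) < (M : ℝ) - 1 := by
    have : (2 : ℝ) ≤ M := by exact_mod_cast hM
    linarith
  refine ⟨⟨outageCoeff_pos hM (div_pos hPs hN₀), fun R hR hQ =>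
    hh.tendsto_outageProb_div hM hN₀ hPs hR hQ⟩, fun r _ hr2 R hR hr =>
    hh.hasDiversity hM hN₀ hPs hR hr hr2, ⟨?_, ?_⟩, ?_, ?_⟩
  · refine ⟨0, fun _ => 1, ⟨1, one_pos, Eventually.of_forall fun _ => le_rfl⟩,
      hasMultiplexingGain_const 1, ?_⟩
    simpa using hh.hasDiversity hM hN₀ hPs ⟨1, one_pos, Eventually.of_forall fun _ => le_rfl⟩
      (hasMultiplexingGain_const 1) (by norm_num)
  · rintro d ⟨r, R, hR, hr, hd⟩
    rcases le_total r (1 / 2) with hr2 | hr2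
    · rw [hd.unique (hh.hasDiversity hM hN₀ hPs hR hr hr2)]
      exact mul_le_of_le_one_left hM1.le (by linarith [hr.nonneg hR])
    · rw [hd.unique (hh.hasDiversity_of_half_le hN₀ hPs hR hr hr2)]
      exact hM1.le
  · rintro r ⟨d, hd0, R, hR, hr, hd⟩
    by_contra hr2
    exact hd0.ne' (hd.unique (hh.hasDiversity_of_half_le hN₀ hPs hR hr (not_le.1 hr2).le))
  · intro b hb
    by_contra hlt
    have hlt' : b < 1 / 2 := not_le.1 hlt
    -- Taking `r` above `0` as well as above `b` makes `r * logb 2 γ` a rate family.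
    obtain ⟨r, hr1, hr2⟩ := exists_between (max_lt hlt' (by norm_num : (0 : ℝ) < 1 / 2))
    have hr0 : 0 < r := (le_max_right _ _).trans_lt hr1
    have hmem : r ∈ {r : ℝ | ∃ d : ℝ, 0 < d ∧ Achieves μ v h N₀ Ps r d} :=
      ⟨(1 - 2 * r) * ((M : ℝ) - 1), mul_pos (by linarith) hM1, fun γ => r * Real.logb 2 γ,
        isRateFamily_mul_logb hr0, hasMultiplexingGain_mul_logb r,
        hh.hasDiversity hM hN₀ hPs (isRateFamily_mul_logb hr0) (hasMultiplexingGain_mul_logb r)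
          hr2.le⟩
    exact absurd (hb hmem) (not_le.2 ((le_max_left _ _).trans_lt hr1))
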